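/- Let $Q\ge 2$ and $1<t<n\le 2t$ be integers, and let $C\subseteq(\mathbb{C}^Q)^{\otimes n}$ be an $[[n,2t-n]]_Q$ quantum MDS code: a subspace of dimension $K=Q^{2t-n}$ with distance $D$ satisfying $2(D-1)=n-(2t-n)$. Here $C$ has distance $D$ if, for every operator $\Gamma$ acting on at most $D-1$ qudits, $\langle\phi_i|\Gamma|\phi_j\rangle=c(\Gamma)\,\delta_{ij}$ for an orthonormal basis $(\phi_i)$ of $C$ when $K>1$, and $\langle\phi|\Gamma|\phi\rangle=Q^{-n}\operatorname{Tr}\Gamma$ for the code state $\phi$ when $K=1$. The $n$ qudits are stored in nodes $W_1,\dots,W_n$. Let $e\in\{1,\dots,n\}$ be the index of an erased qudit, let $\widehat W_e$ be a replacement node, which starts with a qudit in state $|0\rangle$, and let $T\subseteq\{1,\dots,n\}\setminus\{e\}$ be a set of $t$ helper nodes. For a set $H$ of quantum channels (undirected edges) between the nodes $W_i$ ($i\ne e$) and $\widehat W_e$, an erasure correction protocol over $H$ is a finite, possibly adaptive sequence of rounds in which these nodes perform local quantum operations, send finite-dimensional quantum systems over the channels of $H$ only, and communicate classically for free; nobody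 acts on the erased system $W_e$. It must take, with probability one, $|\phi\rangle_{W_1\cdots W_n}|0\rangle_{\widehat W_e}$ to $|\phi\rangle_{W_1\cdots W_{e-1}\widehat W_eW_{e+1}\cdots W_n}|\epsilon\rangle_{W_e}$ for every $\phi\in C$, where $\epsilon$ is some pure state, which may depend on the measurement outcomes. For $h\in H$ let $\beta_h$ be the product of the dimensions of all systems sent over $h$ in either direction (the maximum of this product over the branches of the protocol, if it is adaptive), and define $$\mathrm{EC}_{e,T}(H)=\min\ \sum_{h\in H}\log_Q\beta_h ,$$ the minimum being over all erasure correction protocols over $H$. Let $H_1=\{\{\widehat W_e,W_j\}: j\in T\}$ be the star network with the replacement node as hub. Then the minimum exists and $$\mathrm{EC}_{e,T}(H_1)=2t .$$ Moreover it is attained by a download-and-return protocol, in which each helper node sends its qudit to $\widehat W_e$, then $\widehat W_e$ operates locally and sends one qudit to each helper node, and no other local operation is performed by the nodes other than $\widehat W_e$. -/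

import Mathlib

namespace ErasureCorrection

/-- The Hilbert space of `n` qudits of dimension `Q`, with its computational basis. -/
abbrev Qudits (Q n : ℕ) : Type := EuclideanSpace ℂ (Fin n → Fin Q)

/-! ### Quantum MDS codes -/

/-- The operator on `n` qudits that acts as `G` on the qudits in `S` and as the identity on the
other qudits. -/
def onSubset {Q n : ℕ} (S : Finset (Fin n)) (G : Matrix (S → Fin Q) (S → Fin Q) ℂ) :
    Matrix (Fin n → Fin Q) (Fin n → Fin Q) ℂ :=
  fun x y => if ∀ i, i ∉ S → x i = y i then G (fun i => x i) (fun i => y i) else 0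

/-- The code `C` has distance (at least) `D`.  For `dim C > 1` this is the condition
`⟨φ i| Γ |φ j⟩ = c(Γ) δ i j` for an orthonormal basis `φ` of the code and all operators `Γ` acting
on at most `D - 1` qudits; for `dim C = 1` it is `⟨φ| Γ |φ⟩ = Q ^ (-n) Tr Γ`. -/
def HasDistance {Q n : ℕ} (C : Submodule ℂ (Qudits Q n)) (D : ℕ) : Prop :=
  (1 < Module.finrank ℂ C →
    ∃ b : OrthonormalBasis (Fin (Module.finrank ℂ C)) ℂ C,
      ∀ S : Finset (Fin n), S.card < D → ∀ G : Matrix (S → Fin Q) (S → Fin Q) ℂ,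
        ∃ c : ℂ, ∀ i j,
          inner ℂ (b i : Qudits Q n) (Matrix.toEuclideanLin (onSubset S G) (b j : Qudits Q n))
            = if i = j then c else 0) ∧
  (Module.finrank ℂ C = 1 →
    ∀ φ ∈ C, ‖φ‖ = 1 →
      ∀ S : Finset (Fin n), S.card < D → ∀ G : Matrix (S → Fin Q) (S → Fin Q) ℂ,
        inner ℂ φ (Matrix.toEuclideanLin (onSubset S G) φ)
          = ((Q : ℂ) ^ n)⁻¹ * (onSubset S G).trace)

/-- `C` is an `[[n, k]]_Q` quantum MDS code: it has dimension `Q ^ k`, and its distance attains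
the quantum Singleton bound, `2 (D - 1) = n - k`. -/
def IsQuantumMDS {Q n : ℕ} (k : ℕ) (C : Submodule ℂ (Qudits Q n)) : Prop :=
  Module.finrank ℂ C = Q ^ k ∧
    ∃ D : ℕ, HasDistance C D ∧ 2 * ((D : ℤ) - 1) = (n : ℤ) - (k : ℤ)

/-! ### Protocols with local operations, free classical communication and quantum channels

The parties are indexed by `Fin n`: for `p ≠ e` party `p` is the node `W p`, while the index `e` of
the erased qudit stands for the replacement node.  The erased qudit itself is a separate system on
which nobody acts. -/

/-- Unnormalized pure states of: a memory of dimension `m p` for each party `p`; a system of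
dimension `μ p q` that party `q` has just received from party `p`, for all `p, q`; and the erased
qudit. -/
abbrev State (Q : ℕ) {n : ℕ} (m : Fin n → ℕ) (μ : Fin n → Fin n → ℕ) : Type :=
  (∀ p, Fin (m p)) → (∀ p q, Fin (μ p q)) → Fin Q → ℂ

/-- Local operators of party `p`: from the memory of `p` and the systems received by `p` to the
new memory of `p` and the systems that `p` sends. -/
abbrev LocalOp {n : ℕ} (m : Fin n → ℕ) (μ : Fin n → Fin n → ℕ) (m' : Fin n → ℕ)
    (μ' : Fin n → Fin n → ℕ) (p : Fin n) : Type :=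
  Matrix (Fin (m' p) × (∀ q, Fin (μ' p q))) (Fin (m p) × (∀ q, Fin (μ q p))) ℂ

/-- Apply the tensor product of the local operators `K p` to a state (and deliver the systems
sent). -/
noncomputable def applyLocal {Q n : ℕ} {m : Fin n → ℕ} {μ : Fin n → Fin n → ℕ} {m' : Fin n → ℕ}
    {μ' : Fin n → Fin n → ℕ} (K : ∀ p, LocalOp m μ m' μ' p) (ψ : State Q m μ) : State Q m' μ' :=
  fun x' y' z => ∑ x : (∀ p, Fin (m p)), ∑ y : (∀ p q, Fin (μ p q)),
    (∏ p, K p (x' p, fun q => y' p q) (x p, fun q => y q p)) * ψ x y z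

/-- Finite adaptive protocols over the quantum network `H`, started when the memories have the
dimensions `m` and the last received systems the dimensions `μ`.

In a round each party `p` performs a quantum instrument, given by Kraus operators `K p v` with
outcomes `v`, on the systems it holds.  It sends a system of dimension `μ' p q` to each `q`; this
is trivial (one-dimensional) unless `p` and `q` are joined by a channel of `H`.  All outcomes are
announced to all parties, and the rest of the protocol may depend on them.  (Discarding a system
amounts to measuring it, so operators of this form are enough.)

At the end each party holds one `Q`-dimensional system. -/
inductive Protocol (Q : ℕ) {n : ℕ} (H : SimpleGraph (Fin n)) :
    (m : Fin n → ℕ) → (μ : Fin n → Fin n → ℕ) → Type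
  | done : Protocol Q H (fun _ => Q) (fun _ _ => 1)
  | round {m : Fin n → ℕ} {μ : Fin n → Fin n → ℕ} (m' : Fin n → ℕ) (μ' : Fin n → Fin n → ℕ)
      (channels : ∀ p q, ¬ H.Adj p q → μ' p q = 1)
      (o : Fin n → ℕ) (K : ∀ p, Fin (o p) → LocalOp m μ m' μ' p)
      (complete : ∀ p, ∑ v, (K p v).conjTranspose * K p v = 1)
      (next : (∀ p, Fin (o p)) → Protocol Q H m' μ') : Protocol Q H m μ

namespace Protocol

variable {Q n : ℕ} {H : SimpleGraph (Fin n)}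

/-- The unnormalized final states of all branches of the protocol (the squared norm of such a
state is the probability of the branch). -/
def finalStates : {m : Fin n → ℕ} → {μ : Fin n → Fin n → ℕ} → Protocol Q H m μ →
    State Q m μ → Set (State Q (fun _ : Fin n => Q) (fun _ _ => 1))
  | _, _, done, ψ => {ψ}
  | _, _, round _ _ _ _ K _ next, ψ =>
      {χ | ∃ v, χ ∈ (next v).finalStates (applyLocal (fun p => K p (v p)) ψ)}

/-- The total dimension `β_h` communicated over the channel `h` (in both directions): the product
of the dimensions of all systems sent over `h`, maximized over the branches of the protocol. -/
def channelDim : {m : Fin n → ℕ} → {μ : Fin n → Fin n → ℕ} → Protocol Q H m μ →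
    Sym2 (Fin n) → ℕ
  | _, _, done, _ => 1
  | _, _, round _ μ' _ _ _ _ next, h =>
      Sym2.lift ⟨fun p q => μ' p q * μ' q p, fun _ _ => mul_comm _ _⟩ h *
        Finset.univ.sup (fun v => (next v).channelDim h)

open Classical in
/-- `∑ h ∈ H, log_Q β_h`. -/
noncomputable def cost {m : Fin n → ℕ} {μ : Fin n → Fin n → ℕ} (P : Protocol Q H m μ) : ℝ :=
  ∑ h ∈ H.edgeFinset, Real.logb Q (P.channelDim h)

/-- In every branch, the rounds of the protocol use the message dimensions listed. -/
def HasPattern : {m : Fin n → ℕ} → {μ : Fin n → Fin n → ℕ} → Protocol Q H m μ →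
    List (Fin n → Fin n → ℕ) → Prop
  | _, _, done, l => l = []
  | _, _, round _ μ' _ _ _ _ next, l => ∃ l', l = μ' :: l' ∧ ∀ v, (next v).HasPattern l'

/-- Every party other than `e` only moves basis states between registers.  (At most one of its
registers has dimension larger than one at any time in the use made of this below, so that the
sums are the value stored in that register.) -/
def OnlyHubActs (e : Fin n) : {m : Fin n → ℕ} → {μ : Fin n → Fin n → ℕ} →
    Protocol Q H m μ → Prop
  | _, _, done => True
  | _, _, round _ _ _ _ K _ next =>
      (∀ p, p ≠ e → ∀ v, K p v = Matrix.of fun a b =>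
        if (a.1 : ℕ) + ∑ q, (a.2 q : ℕ) = (b.1 : ℕ) + ∑ q, (b.2 q : ℕ) then 1 else 0) ∧
      ∀ v, (next v).OnlyHubActs e

end Protocol

/-! ### Erasure correction and its entanglement cost -/

/-- Protocols in which each node starts with one `Q`-dimensional system. -/
abbrev StorageProtocol (Q : ℕ) {n : ℕ} (H : SimpleGraph (Fin n)) : Type :=
  Protocol Q H (fun _ => Q) (fun _ _ => 1)

/-- The code state `φ` with qudit `e` in the erased system, and the replacement node in the state
`|0⟩`. -/
noncomputable def erasedState {Q n : ℕ} (e : Fin n) (φ : Qudits Q n) :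
    State Q (fun _ : Fin n => Q) (fun _ _ => 1) :=
  fun x _ z => if (x e : ℕ) = 0 then φ (Function.update x e z) else 0

/-- The protocol corrects the erasure of qudit `e`: for each state `φ` of the code and each branch,
the final state is `φ`, with the replacement node in place of node `e`, in product with some state
`ε` of the erased qudit. -/
def Corrects {Q n : ℕ} {H : SimpleGraph (Fin n)} (C : Submodule ℂ (Qudits Q n)) (e : Fin n)
    (P : StorageProtocol Q H) : Prop :=
  ∀ φ ∈ C, ∀ χ ∈ P.finalStates (erasedState e φ),
    ∃ ε : Fin Q → ℂ, ∀ x y z, χ x y z = φ x * ε z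

/-- The costs of all protocols over `H` that correct the erasure of qudit `e`. -/
def costs {Q n : ℕ} (C : Submodule ℂ (Qudits Q n)) (e : Fin n) (H : SimpleGraph (Fin n)) : Set ℝ :=
  {c | ∃ P : StorageProtocol Q H, Corrects C e P ∧ P.cost = c}

/-- The entanglement cost of correcting the erasure of qudit `e` over the network `H`. -/
noncomputable def entanglementCost {Q n : ℕ} (C : Submodule ℂ (Qudits Q n)) (e : Fin n)
    (H : SimpleGraph (Fin n)) : ℝ :=
  sInf (costs C e H)

/-- The star network with the replacement node as hub and the helper nodes `T` as leaves (nodes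
outside `T` have no quantum channel). -/
def starNetwork {n : ℕ} (e : Fin n) (T : Finset (Fin n)) : SimpleGraph (Fin n) where
  Adj p q := p ≠ q ∧ ((p = e ∧ q ∈ T) ∨ (q = e ∧ p ∈ T))
  symm := ⟨fun _ _ h => ⟨h.1.symm, h.2.symm⟩⟩
  loopless := ⟨fun _ h => h.1 rfl⟩

/-- Download-and-return protocols: each helper sends its qudit to the hub, the hub operates
locally, and then sends one qudit to each helper, which stores it. -/
def IsDownloadAndReturn {Q n : ℕ} {H : SimpleGraph (Fin n)} (e : Fin n) (T : Finset (Fin n))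
    (P : StorageProtocol Q H) : Prop :=
  P.HasPattern [fun p q => if p ∈ T ∧ q = e then Q else 1,
      fun p q => if p = e ∧ q ∈ T then Q else 1, fun _ _ => 1] ∧
    P.OnlyHubActs e

end ErasureCorrection

/-! Everything rests on purity (`IsQuantumMDS.exists_maxMixed`): averaged over a suitable basis, the
code is maximally mixed on every set of `t` qudits. For `K = 1` this is the distance condition
itself. For `K > 1`, split a set `T` of `t` qudits into `U`, with `2t - n` qudits, and `T \ U`. Both
`T \ U` and the complement of `T` have `n - t = D - 1` qudits, hence are uncorrelated with the code
index. Comparing Hilbert-Schmidt norms forces the reduced state on `T` to be a product with the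
maximally mixed state on `U` (`reduced_eq_of_uncorrelated`), and `U` may contain any chosen qudit of
`T`. Since `Q^t = K Q^(n-t)`, the coefficient matrix of the basis across the cut is square, so
orthogonality of its rows gives orthogonality of its columns (`MaxMixed.isometric`).

Lower bound: fix a helper `j` and a branch of nonzero probability. Its operator is a sum of terms
`A_w ⊗ B_w ⊗ D`, where `A_w` acts on `j` and takes at most `β` different values, `β` being the
dimension carried by the channel of `j`, while `D` is the fixed action of the nodes without channels
(`Protocol.exists_branch`). With fewer than `Q²` values some nonzero `X` annihilates every `A_w`.
The recovery equation makes `D` invertible and, because `T` is maximally mixed, determines `∑ A_w ⊗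
B_w`. Pairing this with `X`, then using linear independence over `e` and `T \ {j}` and maximal
mixedness on `{j, e}` (where `t ≥ 2` enters), yields `X ⊗ ε = 0`, a contradiction
(`card_sq_le_of_recovery`). So each of the `t` channels carries at least `Q²`.

Upper bound: the qudits of `T` encode the code index together with a partner of every qudit outside
`T`. The hub measures the partner of the erased qudit, which puts that qudit into a basis state, and
re-encodes on `T ∪ {e}` coherently with the remaining nodes. This is `hubKernel`; isometry on `T`
gives recovery (`sum_hubKernel_mul`), and isometry with maximal mixedness gives the Kraus relation
after scaling (`sum_conj_hubKernel_mul`). One qudit travels each way on each channel, so the cost is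
`2t`. -/

namespace ErasureCorrection
open scoped ComplexConjugate

/-! ### Uncorrelated systems and Hilbert-Schmidt norms. -/

section Purity

variable {I A B C : Type*} [Fintype I] [Fintype A] [Fintype B] [Fintype C]

/-- The squared Hilbert-Schmidt norms of `M * Mᴴ` and `Mᴴ * M` agree. -/
theorem sum_sum_mul_conj_comm {X Y : Type*} [Fintype X] [Fintype Y] (M : X → Y → ℂ) :
    ∑ x, ∑ x', (∑ y, M x y * conj (M x' y)) * conj (∑ y, M x y * conj (M x' y)) =
      ∑ y, ∑ y', (∑ x, conj (M x y) * M x y') * conj (∑ x, conj (M x y) * M x y') := by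
  simp only [map_sum, map_mul, Complex.conj_conj, Finset.sum_mul_sum]
  calc _ = ∑ x, ∑ x', ∑ y, ∑ y', M x y * conj (M x' y) * (conj (M x y') * M x' y') := rfl
    _ = ∑ x, ∑ y, ∑ x', ∑ y', M x y * conj (M x' y) * (conj (M x y') * M x' y') :=
        Finset.sum_congr rfl fun x _ => Finset.sum_comm
    _ = ∑ y, ∑ x, ∑ x', ∑ y', M x y * conj (M x' y) * (conj (M x y') * M x' y') :=
        Finset.sum_comm
    _ = ∑ y, ∑ x, ∑ y', ∑ x', M x y * conj (M x' y) * (conj (M x y') * M x' y') :=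
        Finset.sum_congr rfl fun y _ => Finset.sum_congr rfl fun x _ => Finset.sum_comm
    _ = ∑ y, ∑ y', ∑ x, ∑ x', M x y * conj (M x' y) * (conj (M x y') * M x' y') :=
        Finset.sum_congr rfl fun y _ => Finset.sum_comm
    _ = _ := by
        refine Finset.sum_congr rfl fun y _ => Finset.sum_congr rfl fun y' _ => ?_
        rw [Finset.sum_comm]
        refine Finset.sum_congr rfl fun x _ => Finset.sum_congr rfl fun x' _ => ?_
        ring

/-- Pythagoras for the projection of an operator on `B ⊗ C` to operators of the form `X ⊗ 1`. -/
theorem sum_normSq_sub_partialTrace [DecidableEq C] [Nonempty C] (ρ : B × C → B × C → ℂ) :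
    ∑ x, ∑ x', Complex.normSq (ρ x x' - if x.2 = x'.2 then
        (Fintype.card C : ℂ)⁻¹ * ∑ c, ρ (x.1, c) (x'.1, c) else 0) =
      ∑ x, ∑ x', Complex.normSq (ρ x x') -
        (Fintype.card C : ℝ)⁻¹ * ∑ b, ∑ b', Complex.normSq (∑ c, ρ (b, c) (b', c)) := by
  have hC : (Fintype.card C : ℂ) ≠ 0 := by exact_mod_cast Fintype.card_ne_zero
  apply Complex.ofReal_injective
  push_cast
  simp only [Complex.normSq_eq_conj_mul_self, Fintype.sum_prod_type, map_sub]
  have key : ∀ b b', ∑ c, ∑ c', conj (ρ (b, c) (b', c') - if c = c' then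
        (Fintype.card C : ℂ)⁻¹ * ∑ c, ρ (b, c) (b', c) else 0) *
        (ρ (b, c) (b', c') - if c = c' then
        (Fintype.card C : ℂ)⁻¹ * ∑ c, ρ (b, c) (b', c) else 0) =
      ∑ c, ∑ c', conj (ρ (b, c) (b', c')) * ρ (b, c) (b', c') -
        (Fintype.card C : ℂ)⁻¹ * (conj (∑ c, ρ (b, c) (b', c)) * ∑ c, ρ (b, c) (b', c)) := by
    intro b b'
    set τ := ∑ c, ρ (b, c) (b', c) with hτ
    have h1 : ∀ c c', conj (ρ (b, c) (b', c') - if c = c' then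
        (Fintype.card C : ℂ)⁻¹ * τ else 0) *
        (ρ (b, c) (b', c') - if c = c' then (Fintype.card C : ℂ)⁻¹ * τ else 0) =
        conj (ρ (b, c) (b', c')) * ρ (b, c) (b', c') +
        (if c = c' then - ((Fintype.card C : ℂ)⁻¹ * τ * conj (ρ (b, c) (b', c')) +
          (Fintype.card C : ℂ)⁻¹ * conj τ * ρ (b, c) (b', c')) +
          (Fintype.card C : ℂ)⁻¹ * (Fintype.card C : ℂ)⁻¹ * (conj τ * τ) else 0) := by
      intro c c'
      split_ifs with h
      · simp only [map_sub, map_mul, map_inv₀, Complex.conj_natCast, h]; ring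
      · simp
    simp only [h1, Finset.sum_add_distrib, Finset.sum_ite_eq, Finset.mem_univ, if_true,
      Finset.sum_neg_distrib, ← Finset.mul_sum, ← map_sum, ← hτ, Finset.sum_const,
      Finset.card_univ, nsmul_eq_mul]
    field_simp
    ring
  calc _ = ∑ b, ∑ b', ∑ c, ∑ c', conj (ρ (b, c) (b', c') - if c = c' then
        (Fintype.card C : ℂ)⁻¹ * ∑ c, ρ (b, c) (b', c) else 0) *
        (ρ (b, c) (b', c') - if c = c' then
        (Fintype.card C : ℂ)⁻¹ * ∑ c, ρ (b, c) (b', c) else 0) := by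
        refine Finset.sum_congr rfl fun b _ => ?_
        rw [Finset.sum_comm]
        simp only [map_sub]
    _ = _ := by
        simp only [key, Finset.sum_sub_distrib, ← Finset.mul_sum]
        congr 1
        refine Finset.sum_congr rfl fun b _ => ?_
        rw [Finset.sum_comm]

variable [DecidableEq I]

/-- The Hilbert-Schmidt norm of the reduced state on `B ⊗ C`, if `A` is uncorrelated with the
reference system `I`. -/
theorem sum_normSq_reduced (F : I → A → B → C → ℂ) (σ : A → A → ℂ)
    (hA : ∀ i j a a', ∑ b, ∑ c, conj (F i a b c) * F j a' b c = if i = j then σ a a' else 0) :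
    ∑ x : B × C, ∑ x' : B × C,
        Complex.normSq (∑ i, ∑ a, F i a x.1 x.2 * conj (F i a x'.1 x'.2)) =
      Fintype.card I * ∑ a, ∑ a', Complex.normSq (σ a a') := by
  apply Complex.ofReal_injective
  push_cast
  have := sum_sum_mul_conj_comm (fun (x : B × C) (y : I × A) => F y.1 y.2 x.1 x.2)
  simp only [Complex.mul_conj, Fintype.sum_prod_type, hA] at this ⊢
  rw [this]
  calc _ = ∑ i : I, ∑ a, ∑ j, ∑ a', if i = j then (Complex.normSq (σ a a') : ℂ) else 0 := by
        refine Finset.sum_congr rfl fun i _ => Finset.sum_congr rfl fun a _ =>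
          Finset.sum_congr rfl fun j _ => Finset.sum_congr rfl fun a' _ => ?_
        split_ifs <;> simp
    _ = ∑ i : I, ∑ a, ∑ a', (Complex.normSq (σ a a') : ℂ) := by
        refine Finset.sum_congr rfl fun i _ => Finset.sum_congr rfl fun a _ => ?_
        rw [Finset.sum_comm]
        simp
    _ = _ := by simp

/-- Each index `i` contributes the same operator `σ` (transposed) on `B`, so the sum over `i` scales
it by `|I|` and the squared norm by `|I|²`. -/
theorem sum_normSq_partialTrace_reduced (F : I → A → B → C → ℂ) (σ : B → B → ℂ)
    (hB : ∀ i j b b', ∑ a, ∑ c, conj (F i a b c) * F j a b' c = if i = j then σ b b' else 0) :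
    ∑ b, ∑ b', Complex.normSq (∑ c, ∑ i, ∑ a, F i a b c * conj (F i a b' c)) =
      (Fintype.card I : ℝ) ^ 2 * ∑ b, ∑ b', Complex.normSq (σ b b') := by
  have h : ∀ b b', ∑ c, ∑ i, ∑ a, F i a b c * conj (F i a b' c) = Fintype.card I * σ b' b := by
    intro b b'
    calc _ = ∑ i, ∑ a, ∑ c, conj (F i a b' c) * F i a b c := by
          rw [Finset.sum_comm]
          refine Finset.sum_congr rfl fun i _ => ?_
          rw [Finset.sum_comm]
          simp only [mul_comm]
      _ = _ := by simp [hB]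
  simp only [h, Complex.normSq_mul, Complex.normSq_natCast]
  rw [Finset.sum_comm]
  simp only [← Finset.mul_sum]
  ring

/-- If `A` and `B` are uncorrelated with the reference system `I`, which is as large as `C`, then the
reduced state on `B ⊗ C` is a product with the maximally mixed state on `C`. -/
theorem reduced_eq_of_uncorrelated [DecidableEq C] [Nonempty C] (F : I → A → B → C → ℂ)
    (hcard : Fintype.card C = Fintype.card I) (σA : A → A → ℂ) (σB : B → B → ℂ)
    (hA : ∀ i j a a', ∑ b, ∑ c, conj (F i a b c) * F j a' b c = if i = j then σA a a' else 0)
    (hB : ∀ i j b b', ∑ a, ∑ c, conj (F i a b c) * F j a b' c = if i = j then σB b b' else 0)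
    (b b' : B) (c c' : C) :
    ∑ i, ∑ a, F i a b c * conj (F i a b' c') = if c = c' then
      (Fintype.card C : ℂ)⁻¹ * ∑ d, ∑ i, ∑ a, F i a b d * conj (F i a b' d) else 0 := by
  have hI : (0 : ℝ) < Fintype.card I := by rw [← hcard]; exact_mod_cast Fintype.card_pos
  have e1 := sum_normSq_sub_partialTrace
    (fun x x' : B × C => ∑ i, ∑ a, F i a x.1 x.2 * conj (F i a x'.1 x'.2))
  have e2 := sum_normSq_sub_partialTrace
    (fun x x' : A × C => ∑ i, ∑ b, F i x.1 b x.2 * conj (F i x'.1 b x'.2))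
  rw [sum_normSq_reduced F σA hA] at e1
  rw [sum_normSq_reduced (fun i b a c => F i a b c) σB hB] at e2
  have p1 := sum_normSq_partialTrace_reduced F σB hB
  have p2 := sum_normSq_partialTrace_reduced (fun i b a c => F i a b c) σA hA
  simp only at e1 e2 p2
  rw [p1, hcard] at e1
  rw [p2, hcard] at e2
  -- As `|C| = |I|`, the squared distance from a product is `|I| (‖σA‖² - ‖σB‖²)` on `B ⊗ C` and
  -- exactly the negative of this on `A ⊗ C`. Both are sums of squares, so both vanish.
  have q2 : 0 ≤ (Fintype.card I : ℝ) * ∑ b, ∑ b', Complex.normSq (σB b b') -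
      (Fintype.card I : ℝ)⁻¹ * ((Fintype.card I : ℝ) ^ 2 *
        ∑ a, ∑ a', Complex.normSq (σA a a')) := by
    rw [← e2]
    exact Finset.sum_nonneg fun _ _ => Finset.sum_nonneg fun _ _ => Complex.normSq_nonneg _
  have hle : (Fintype.card I : ℝ) * ∑ a, ∑ a', Complex.normSq (σA a a') -
      (Fintype.card I : ℝ)⁻¹ * ((Fintype.card I : ℝ) ^ 2 *
        ∑ b, ∑ b', Complex.normSq (σB b b')) ≤ 0 := by
    field_simp at q2 ⊢
    linarith
  rw [← e1] at hle
  have z := le_antisymm hle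
    (Finset.sum_nonneg fun _ _ => Finset.sum_nonneg fun _ _ => Complex.normSq_nonneg _)
  rw [Finset.sum_eq_zero_iff_of_nonneg
    fun _ _ => Finset.sum_nonneg fun _ _ => Complex.normSq_nonneg _] at z
  have z1 := z (b, c) (Finset.mem_univ _)
  rw [Finset.sum_eq_zero_iff_of_nonneg fun _ _ => Complex.normSq_nonneg _] at z1
  have z2 := z1 (b', c') (Finset.mem_univ _)
  rw [Complex.normSq_eq_zero, sub_eq_zero] at z2
  rw [hcard]
  exact z2

end Purity

/-! ### Maximally mixed and isometric cuts of a family of vectors. -/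

section Piecewise

variable {ι α I : Type*} [DecidableEq ι]

/-- Configurations as pairs of a configuration on `S` and one off `S`. -/
abbrev splitEquiv (α : Type*) (S : Finset ι) : (ι → α) ≃ (S → α) × ({p // p ∉ S} → α) :=
  Equiv.piEquivPiSubtypeProd (· ∈ S) fun _ => α

theorem piecewise_splitEquiv_symm_right (S : Finset ι) (x : ι → α) (r) :
    S.piecewise x ((splitEquiv α S).symm r) = (splitEquiv α S).symm (fun p => x p, r.2) := by
  ext p; by_cases hp : p ∈ S <;> simp [Equiv.piEquivPiSubtypeProd, Finset.piecewise, hp]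

theorem piecewise_splitEquiv_symm_left (S : Finset ι) (y : ι → α) (r) :
    S.piecewise ((splitEquiv α S).symm r) y = (splitEquiv α S).symm (r.1, fun p => y p) := by
  ext p; by_cases hp : p ∈ S <;> simp [Equiv.piEquivPiSubtypeProd, Finset.piecewise, hp]

variable [Fintype ι] [Fintype α]

/-- Summing over a redundant family of coordinates. -/
theorem sum_sum_piecewise (S : Finset ι) (h : (ι → α) → ℂ) :
    ∑ z, ∑ y, h (S.piecewise z y) = Fintype.card (ι → α) * ∑ y, h y := by
  -- The involution exchanges the coordinates off `S` of the two configurations.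
  let e : (ι → α) × (ι → α) ≃ (ι → α) × (ι → α) :=
    { toFun := fun p => (S.piecewise p.1 p.2, S.piecewise p.2 p.1)
      invFun := fun p => (S.piecewise p.1 p.2, S.piecewise p.2 p.1)
      left_inv := fun p => by
        ext q <;> by_cases hq : q ∈ S <;> simp [Finset.piecewise, hq]
      right_inv := fun p => by
        ext q <;> by_cases hq : q ∈ S <;> simp [Finset.piecewise, hq] }
  calc _ = ∑ p : (ι → α) × (ι → α), h (S.piecewise p.1 p.2) := by rw [Fintype.sum_prod_type]
    _ = ∑ p : (ι → α) × (ι → α), h p.1 := Fintype.sum_equiv e _ _ fun p => rfl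
    _ = _ := by rw [Fintype.sum_prod_type, Finset.sum_comm]; simp

/-- The family `f` is orthonormal, and remains so if the systems off `S` are projected to elements
of the computational basis. -/
def Isometric (f : I → (ι → α) → ℂ) (S : Finset ι) : Prop :=
  (∀ i y y', (∀ p, p ∉ S → y p = y' p) →
      ∑ x, conj (f i (S.piecewise x y)) * f i (S.piecewise x y') = 1) ∧
    ∀ i j y y', ¬ (i = j ∧ ∀ p, p ∉ S → y p = y' p) →
      ∑ x, conj (f i (S.piecewise x y)) * f j (S.piecewise x y') = 0

/-- A sum over configurations on `S'` is an average of sums over configurations on `S` with the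
coordinates in `S' \ S` fixed. Summing over full configurations, with redundant coordinates, keeps
the constant equal to 1 for every set. -/
theorem Isometric.mono [Nonempty α] {f : I → (ι → α) → ℂ} {S S' : Finset ι}
    (h : Isometric f S) (hS : S ⊆ S') : Isometric f S' := by
  have hN : (Fintype.card (ι → α) : ℂ) ≠ 0 := by exact_mod_cast Fintype.card_ne_zero
  have key : ∀ i j y y', ∑ z, ∑ x, conj (f i (S.piecewise x (S'.piecewise z y))) *
      f j (S.piecewise x (S'.piecewise z y')) = Fintype.card (ι → α) *
        ∑ x, conj (f i (S'.piecewise x y)) * f j (S'.piecewise x y') := by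
    intro i j y y'
    rw [← sum_sum_piecewise S
      (fun x => conj (f i (S'.piecewise x y)) * f j (S'.piecewise x y')), Finset.sum_comm]
    have : ∀ x z y : ι → α, S.piecewise x (S'.piecewise z y) =
        S'.piecewise (S.piecewise x z) y := by
      intro x z y; ext p
      by_cases hp : p ∈ S
      · simp [Finset.piecewise, hp, hS hp]
      · simp [Finset.piecewise, hp]
    simp only [this]
  constructor
  · intro i y y' hy
    apply mul_left_cancel₀ hN
    rw [← key]
    calc _ = ∑ z : ι → α, (1 : ℂ) := by
          refine Finset.sum_congr rfl fun z _ => h.1 _ _ _ fun p hp => ?_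
          by_cases hp' : p ∈ S'
          · simp [Finset.piecewise, hp']
          · simp [Finset.piecewise, hp', hy p hp']
      _ = _ := by simp
  · intro i j y y' hy
    apply mul_left_cancel₀ hN
    rw [← key, mul_zero]
    refine Finset.sum_eq_zero fun z _ => h.2 _ _ _ _ fun ⟨h1, h2⟩ => hy ⟨h1, fun p hp => ?_⟩
    simpa [Finset.piecewise, hp] using h2 p (fun h3 => hp (hS h3))

variable [Fintype I]

/-- The reduced state on `S` of the family `f`, up to a factor. -/
def reduced (f : I → (ι → α) → ℂ) (S : Finset ι) (x x' : ι → α) : ℂ :=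
  ∑ i, ∑ y, f i (S.piecewise x y) * conj (f i (S.piecewise x' y))

/-- The reduced state of the family `f` on `S` is maximally mixed. -/
def MaxMixed (f : I → (ι → α) → ℂ) (S : Finset ι) : Prop :=
  (∀ x x', (∀ p ∈ S, x p = x' p) → reduced f S x x' = Fintype.card I) ∧
    ∀ x x', (¬ ∀ p ∈ S, x p = x' p) → reduced f S x x' = 0

/-- Tracing out `S \ S'` is averaging over common values there. The redundant coordinates in
`reduced` make the diagonal value `|I|` independent of the set. -/
theorem MaxMixed.mono [Nonempty α] {f : I → (ι → α) → ℂ} {S S' : Finset ι} (h : MaxMixed f S)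
    (hS : S' ⊆ S) : MaxMixed f S' := by
  have hN : (Fintype.card (ι → α) : ℂ) ≠ 0 := by exact_mod_cast Fintype.card_ne_zero
  have key : ∀ x x', ∑ z, reduced f S (S'.piecewise x z) (S'.piecewise x' z) =
      Fintype.card (ι → α) * reduced f S' x x' := by
    intro x x'
    simp only [reduced]
    rw [Finset.sum_comm, Finset.mul_sum]
    refine Finset.sum_congr rfl fun i _ => ?_
    rw [← sum_sum_piecewise S
      (fun y => f i (S'.piecewise x y) * conj (f i (S'.piecewise x' y)))]
    refine Finset.sum_congr rfl fun z _ => Finset.sum_congr rfl fun y _ => ?_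
    have : ∀ x : ι → α, S.piecewise (S'.piecewise x z) y =
        S'.piecewise x (S.piecewise z y) := by
      intro x; ext p
      by_cases hp : p ∈ S'
      · simp [Finset.piecewise, hp, hS hp]
      · simp [Finset.piecewise, hp]
    rw [this, this]
  constructor
  · intro x x' hx
    apply mul_left_cancel₀ hN
    rw [← key]
    calc _ = ∑ z : ι → α, (Fintype.card I : ℂ) := by
          refine Finset.sum_congr rfl fun z _ => h.1 _ _ fun p hp => ?_
          by_cases hp' : p ∈ S'
          · simp [Finset.piecewise, hp', hx p hp']
          · simp [Finset.piecewise, hp']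
      _ = _ := by simp
  · intro x x' hx
    apply mul_left_cancel₀ hN
    rw [← key, mul_zero]
    refine Finset.sum_eq_zero fun z _ => h.2 _ _ fun hx2 => hx fun p hp => ?_
    simpa [Finset.piecewise, hp] using hx2 p (hS hp)

/-- A square matrix with orthogonal rows has orthogonal columns. -/
theorem MaxMixed.isometric [Nonempty α] [Nonempty I] {f : I → (ι → α) → ℂ} {S : Finset ι}
    (h : MaxMixed f S)
    (hcard : Fintype.card (S → α) = Fintype.card I * Fintype.card ({p // p ∉ S} → α)) :
    Isometric f S := by
  classical
  set M : Matrix (S → α) (I × ({p // p ∉ S} → α)) ℂ :=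
    Matrix.of fun a r => f r.1 ((splitEquiv α S).symm (a, r.2)) with hM
  set r : ℂ := ((Fintype.card ({p // p ∉ S} → α) : ℕ) : ℂ) with hr
  set s : ℂ := ((Fintype.card (S → α) : ℕ) : ℂ) with hs
  have hr0 : r ≠ 0 := by rw [hr]; exact_mod_cast Fintype.card_ne_zero
  have hs0 : s ≠ 0 := by rw [hs]; exact_mod_cast Fintype.card_ne_zero
  have hrow : ∀ x x', reduced f S x x' =
      s * (M * M.conjTranspose) (fun p => x p) (fun p => x' p) := by
    intro x x'
    simp only [reduced, Matrix.mul_apply, Fintype.sum_prod_type, Finset.mul_sum]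
    refine Finset.sum_congr rfl fun i _ => ?_
    rw [← (splitEquiv α S).symm.sum_comp, Fintype.sum_prod_type]
    simp [piecewise_splitEquiv_symm_right, hM, hs, Finset.mul_sum]
  have hcol : ∀ i j y y', ∑ x, conj (f i (S.piecewise x y)) * f j (S.piecewise x y') =
      r * (M.conjTranspose * M) (i, fun p => y p) (j, fun p => y' p) := by
    intro i j y y'
    rw [← (splitEquiv α S).symm.sum_comp, Fintype.sum_prod_type]
    simp [piecewise_splitEquiv_symm_left, hM, hr, Finset.mul_sum, Matrix.mul_apply]
  -- Rows have squared norm `|I| / s`, and `s = |I| r` because the matrix is square; hence the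
  -- scaling by `r`.
  have hMM : M * (r • M.conjTranspose) = 1 := by
    ext a a'
    obtain ⟨z⟩ : Nonempty (ι → α) := inferInstance
    have h1 := hrow ((splitEquiv α S).symm (a, fun p => z p))
      ((splitEquiv α S).symm (a', fun p => z p))
    have hres : ∀ a : S → α, (fun p : S => (splitEquiv α S).symm (a, fun p => z p) p) = a := by
      intro a; ext p; simp [Equiv.piEquivPiSubtypeProd]
    rw [hres, hres] at h1
    rw [Matrix.mul_smul, Matrix.smul_apply, smul_eq_mul, Matrix.one_apply]
    have hag : (∀ p ∈ S, (splitEquiv α S).symm (a, fun p => z p) p =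
        (splitEquiv α S).symm (a', fun p => z p) p) ↔ a = a' := by
      constructor
      · intro h2; ext p; rw [← congrFun (hres a) p, ← congrFun (hres a') p]; exact h2 p p.2
      · rintro rfl; simp
    have hcard' : s = Fintype.card I * r := by rw [hs, hr, hcard]; push_cast; rfl
    split_ifs with haa
    · rw [h.1 _ _ (hag.2 haa)] at h1
      have : (Fintype.card I : ℂ) ≠ 0 := by exact_mod_cast Fintype.card_ne_zero
      rw [hcard', mul_assoc] at h1
      exact (mul_left_cancel₀ this (by rw [mul_one]; exact h1)).symm
    · rw [h.2 _ _ (fun h3 => haa (hag.1 h3))] at h1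
      rcases mul_eq_zero.1 h1.symm with h2 | h2
      · exact absurd h2 hs0
      · rw [h2, mul_zero]
  have hMM' : r • M.conjTranspose * M = 1 :=
    (Matrix.mul_eq_one_comm_of_card_eq _ _ _ (by rw [Fintype.card_prod, hcard])).1 hMM
  rw [Matrix.smul_mul] at hMM'
  have hcol' : ∀ i j y y', ∑ x, conj (f i (S.piecewise x y)) * f j (S.piecewise x y') =
      (1 : Matrix (I × ({p // p ∉ S} → α)) (I × ({p // p ∉ S} → α)) ℂ)
        (i, fun p => y p) (j, fun p => y' p) := by
    intro i j y y'
    rw [hcol, ← hMM', Matrix.smul_apply, smul_eq_mul]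
  refine ⟨fun i y y' hy => ?_, fun i j y y' hy => ?_⟩
  · rw [hcol', Matrix.one_apply, if_pos]
    simp only [Prod.mk.injEq, true_and]
    ext p; exact hy p p.2
  · rw [hcol', Matrix.one_apply, if_neg]
    simp only [Prod.mk.injEq, funext_iff, Subtype.forall]
    exact hy

end Piecewise

/-! ### From uncorrelated subsets to maximal mixedness. -/

section Uncorrelated

variable {ι α I : Type*} [DecidableEq ι]

/-- Configurations as triples of configurations off `T`, on `T \ U` and on `U`. -/
def splitEquiv₃ (α : Type*) {T U : Finset ι} (h : U ⊆ T) :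
    (ι → α) ≃ ({p // p ∉ T} → α) × ({p // p ∈ T ∧ p ∉ U} → α) × ({p // p ∈ U} → α) where
  toFun x := (fun p => x p, fun p => x p, fun p => x p)
  invFun r p := if hU : p ∈ U then r.2.2 ⟨p, hU⟩ else
    if hT : p ∈ T then r.2.1 ⟨p, hT, hU⟩ else r.1 ⟨p, hT⟩
  left_inv x := by ext p; simp
  right_inv r := by
    refine Prod.ext ?_ (Prod.ext ?_ ?_)
    · ext ⟨p, hp⟩
      have : p ∉ U := fun h' => hp (h h')
      simp [hp, this]
    · ext ⟨p, hp⟩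
      simp [hp.1, hp.2]
    · ext ⟨p, hp⟩
      simp [hp]

theorem piecewise_splitEquiv₃_symm {T U : Finset ι} (h : U ⊆ T) (x : ι → α) (a b c) :
    T.piecewise x ((splitEquiv₃ α h).symm (a, b, c)) =
      (splitEquiv₃ α h).symm (a, fun p => x p, fun p => x p) := by
  ext p
  by_cases hU : p ∈ U
  · simp [splitEquiv₃, hU, Finset.piecewise, h hU]
  · by_cases hT : p ∈ T <;> simp [splitEquiv₃, hU, hT, Finset.piecewise]

theorem piecewise_compl_splitEquiv₃_symm [Fintype ι] {T U : Finset ι} (h : U ⊆ T) (x : ι → α)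
    (a b c) : Tᶜ.piecewise x ((splitEquiv₃ α h).symm (a, b, c)) =
      (splitEquiv₃ α h).symm (fun p => x p, b, c) := by
  ext p
  by_cases hU : p ∈ U
  · simp [splitEquiv₃, hU, Finset.piecewise, h hU]
  · by_cases hT : p ∈ T <;> simp [splitEquiv₃, hU, hT, Finset.piecewise]

theorem piecewise_sdiff_splitEquiv₃_symm {T U : Finset ι} (h : U ⊆ T) (x : ι → α)
    (a b c) : (T \ U).piecewise x ((splitEquiv₃ α h).symm (a, b, c)) =
      (splitEquiv₃ α h).symm (a, fun p => x p, c) := by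
  ext p
  by_cases hU : p ∈ U
  · simp [splitEquiv₃, hU, Finset.piecewise]
  · by_cases hT : p ∈ T <;> simp [splitEquiv₃, hU, hT, Finset.piecewise]

variable [Fintype ι] [Fintype α] [Fintype I]

/-- The systems in `S` are uncorrelated with the index of the family `f`. -/
def Uncorrelated (f : I → (ι → α) → ℂ) (S : Finset ι) : Prop :=
  ∃ σ : (ι → α) → (ι → α) → ℂ,
    (∀ i x x', ∑ y, conj (f i (S.piecewise x y)) * f i (S.piecewise x' y) = σ x x') ∧
    ∀ i j x x', i ≠ j → ∑ y, conj (f i (S.piecewise x y)) * f j (S.piecewise x' y) = 0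

/-- This is `reduced_eq_of_uncorrelated` with `A`, `B`, `C` the systems off `T`, on `T \ U` and on
`U`. The two conclusions together express that the state on `T` is a product with the maximally
mixed state on `U`. -/
theorem reduced_of_uncorrelated [Nonempty α] (f : I → (ι → α) → ℂ) {T U : Finset ι} (hU : U ⊆ T)
    (hcard : Fintype.card ({p // p ∈ U} → α) = Fintype.card I)
    (hA : Uncorrelated f Tᶜ) (hB : Uncorrelated f (T \ U)) :
    (∀ x x', (¬ ∀ p ∈ U, x p = x' p) → reduced f T x x' = 0) ∧
      ∀ x x' z, (∀ p ∈ U, x p = x' p) →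
        reduced f T (U.piecewise z x) (U.piecewise z x') = reduced f T x x' := by
  classical
  obtain ⟨σA, hA1, hA2⟩ := hA
  obtain ⟨σB, hB1, hB2⟩ := hB
  obtain ⟨w⟩ : Nonempty (ι → α) := inferInstance
  set e := splitEquiv₃ α hU with he
  set F : I → ({p // p ∉ T} → α) → ({p // p ∈ T ∧ p ∉ U} → α) → ({p // p ∈ U} → α) → ℂ :=
    fun i a b c => f i (e.symm (a, b, c)) with hF
  set nA : ℂ := ((Fintype.card ({p // p ∉ T} → α) : ℕ) : ℂ)
  set nB : ℂ := ((Fintype.card ({p // p ∈ T ∧ p ∉ U} → α) : ℕ) : ℂ)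
  set nC : ℂ := ((Fintype.card ({p // p ∈ U} → α) : ℕ) : ℂ)
  have hnA : nA ≠ 0 := by simp only [nA]; exact_mod_cast Fintype.card_ne_zero
  have hnB : nB ≠ 0 := by simp only [nB]; exact_mod_cast Fintype.card_ne_zero
  have hresA : ∀ a b c, (fun p : {p // p ∉ T} => e.symm (a, b, c) p) = a := fun a b c =>
    congrArg Prod.fst (e.apply_symm_apply (a, b, c))
  have hresB : ∀ a b c, (fun p : {p // p ∈ T ∧ p ∉ U} => e.symm (a, b, c) p) = b := fun a b c =>
    congrArg (fun r => r.2.1) (e.apply_symm_apply (a, b, c))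
  have hred : ∀ x x', reduced f T x x' = nB * nC * ∑ i, ∑ a, F i a (fun p => x p) (fun p => x p) *
      conj (F i a (fun p => x' p) (fun p => x' p)) := by
    intro x x'
    simp only [reduced, Finset.mul_sum]
    refine Finset.sum_congr rfl fun i _ => ?_
    rw [← e.symm.sum_comp, Fintype.sum_prod_type]
    refine Finset.sum_congr rfl fun a _ => ?_
    rw [Fintype.sum_prod_type]
    simp only [he, piecewise_splitEquiv₃_symm, hF]
    simp [nB, nC, mul_assoc]
  have hA' : ∀ i j a a', ∑ b, ∑ c, conj (F i a b c) * F j a' b c = if i = j then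
      nA⁻¹ * σA (e.symm (a, fun p => w p, fun p => w p)) (e.symm (a', fun p => w p, fun p => w p))
      else 0 := by
    intro i j a a'
    have h1 : ∑ y, conj (f i (Tᶜ.piecewise (e.symm (a, fun p => w p, fun p => w p)) y)) *
        f j (Tᶜ.piecewise (e.symm (a', fun p => w p, fun p => w p)) y) =
        nA * ∑ b, ∑ c, conj (F i a b c) * F j a' b c := by
      rw [← e.symm.sum_comp]
      simp only [Fintype.sum_prod_type, he, piecewise_compl_splitEquiv₃_symm]
      simp only [← he, hresA, hF]
      simp [nA]
    split_ifs with hij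
    · subst hij
      rw [← hA1 i, h1, inv_mul_cancel_left₀ hnA]
    · rw [hA2 i j _ _ hij] at h1
      exact (mul_eq_zero.1 h1.symm).resolve_left hnA
  have hB' : ∀ i j b b', ∑ a, ∑ c, conj (F i a b c) * F j a b' c = if i = j then
      nB⁻¹ * σB (e.symm (fun p => w p, b, fun p => w p)) (e.symm (fun p => w p, b', fun p => w p))
      else 0 := by
    intro i j b b'
    have h1 : ∑ y, conj (f i ((T \ U).piecewise (e.symm (fun p => w p, b, fun p => w p)) y)) *
        f j ((T \ U).piecewise (e.symm (fun p => w p, b', fun p => w p)) y) =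
        nB * ∑ a, ∑ c, conj (F i a b c) * F j a b' c := by
      rw [← e.symm.sum_comp]
      simp only [Fintype.sum_prod_type, he, piecewise_sdiff_splitEquiv₃_symm]
      simp only [← he, hresB, hF]
      simp [nB, Finset.mul_sum]
    split_ifs with hij
    · subst hij
      rw [← hB1 i, h1, inv_mul_cancel_left₀ hnB]
    · rw [hB2 i j _ _ hij] at h1
      exact (mul_eq_zero.1 h1.symm).resolve_left hnB
  have hmain := reduced_eq_of_uncorrelated F hcard _ _ hA' hB'
  constructor
  · intro x x' hx
    rw [hred, hmain, if_neg, mul_zero]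
    intro h
    exact hx fun p hp => congrFun h ⟨p, hp⟩
  · intro x x' z hx
    have hx' : (fun p => x p : {p // p ∈ U} → α) = fun p => x' p.1 := funext fun p => hx p p.2
    have hz : ∀ x : ι → α, (fun p => U.piecewise z x p : {p // p ∈ U} → α) = fun p => z p.1 := by
      intro x; ext ⟨p, hp⟩; simp [Finset.piecewise, hp]
    have hz2 : ∀ x : ι → α, (fun p => U.piecewise z x p : {p // p ∈ T ∧ p ∉ U} → α) =
        fun p => x p.1 := by
      intro x; ext ⟨p, hp⟩; simp [Finset.piecewise, hp.2]
    rw [hred, hmain, hred, hmain]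
    simp only [hz, hz2, hx', if_true]

/-- Every `k ∈ T` lies in some `U` on which the state factors off as maximally mixed. Hence entries
whose indices differ at `k` vanish and diagonal entries do not depend on the value at `k`; the
diagonal is constant on `T`, and the trace fixes its value. -/
theorem maxMixed_of_forall_uncorrelated [Nonempty α] (f : I → (ι → α) → ℂ) {T : Finset ι}
    (hf : ∀ i, ∑ x, conj (f i x) * f i x = 1)
    (h : ∀ k ∈ T, ∃ U ⊆ T, k ∈ U ∧ Fintype.card ({p // p ∈ U} → α) = Fintype.card I ∧
      Uncorrelated f Tᶜ ∧ Uncorrelated f (T \ U)) : MaxMixed f T := by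
  have hN : (Fintype.card (ι → α) : ℂ) ≠ 0 := by exact_mod_cast Fintype.card_ne_zero
  have hupd : ∀ x, ∀ k ∈ T, ∀ v, reduced f T (Function.update x k v) (Function.update x k v) =
      reduced f T x x := by
    intro x k hk v
    obtain ⟨U, hUT, hkU, hcard, hA, hB⟩ := h k hk
    rw [← (reduced_of_uncorrelated f hUT hcard hA hB).2 x x (Function.update x k v)
      fun _ _ => rfl]
    have : U.piecewise (Function.update x k v) x = Function.update x k v := by
      ext p
      by_cases hp : p = k
      · subst hp; simp [Finset.piecewise, hkU]
      · simp [Finset.piecewise, hp]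
    rw [this]
  have hloc : ∀ x x', (∀ p ∈ T, x p = x' p) → reduced f T x x' = reduced f T x x := by
    intro x x' hx
    have : ∀ y, T.piecewise x' y = T.piecewise x y := by
      intro y; ext p
      by_cases hp : p ∈ T <;> simp [Finset.piecewise, hp]
      exact (hx p hp).symm
    simp [reduced, this]
  have hset : ∀ x z, ∀ s ⊆ T, reduced f T (s.piecewise z x) (s.piecewise z x) =
      reduced f T x x := by
    intro x z s
    induction s using Finset.induction_on with
    | empty => simp
    | insert k s hk ih =>
      intro hs
      rw [Finset.piecewise_insert, hupd _ k (hs (Finset.mem_insert_self _ _)),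
        ih fun p hp => hs (Finset.mem_insert_of_mem hp)]
  have hconst : ∀ x z, reduced f T x x = reduced f T z z := by
    intro x z
    have : ∀ y, T.piecewise (T.piecewise z x) y = T.piecewise z y := by
      intro y; ext p
      by_cases hp : p ∈ T <;> simp [Finset.piecewise, hp]
    rw [← hset x z T subset_rfl]
    simp [reduced, this]
  -- Normalization of the vectors enters only here.
  have htrace : ∑ x, reduced f T x x = Fintype.card (ι → α) * Fintype.card I := by
    simp only [reduced]
    rw [Finset.sum_comm]
    have : ∀ i, ∑ x, ∑ y, f i (T.piecewise x y) * conj (f i (T.piecewise x y)) =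
        Fintype.card (ι → α) := by
      intro i
      rw [sum_sum_piecewise T (fun x => f i x * conj (f i x))]
      simp only [mul_comm (f i _), hf, mul_one]
    simp only [this, Finset.sum_const, Finset.card_univ, nsmul_eq_mul]
    ring
  refine ⟨fun x x' hx => ?_, fun x x' hx => ?_⟩
  · rw [hloc x x' hx]
    apply mul_left_cancel₀ hN
    rw [← htrace, Finset.sum_congr rfl fun z _ => hconst z x]
    simp
  · push Not at hx
    obtain ⟨k, hk, hne⟩ := hx
    obtain ⟨U, hUT, hkU, hcard, hA, hB⟩ := h k hk
    exact (reduced_of_uncorrelated f hUT hcard hA hB).1 x x' fun h => hne (h k hkU)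

end Uncorrelated

/-! ### Purity of quantum MDS codes. -/

section Codes

variable {Q n : ℕ}

/-- The matrix unit `|x⟩⟨x'|` on the qudits in `S`. -/
def matrixUnit (S : Finset (Fin n)) (x x' : Fin n → Fin Q) : Matrix (S → Fin Q) (S → Fin Q) ℂ :=
  fun r s => if r = (fun p : S => x p) ∧ s = (fun p : S => x' p) then 1 else 0

theorem onSubset_matrixUnit_splitEquiv_symm (S : Finset (Fin n)) (x x' : Fin n → Fin Q)
    (r s : (S → Fin Q) × ({p // p ∉ S} → Fin Q)) :
    onSubset S (matrixUnit S x x') ((splitEquiv _ S).symm r) ((splitEquiv _ S).symm s) =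
      if s.2 = r.2 then if r.1 = (fun p : S => x p) then
        if s.1 = (fun p : S => x' p) then 1 else 0 else 0 else 0 := by
  have hres : ∀ r, (fun p : S => (splitEquiv (Fin Q) S).symm r p) = r.1 := fun r =>
    congrArg Prod.fst ((splitEquiv (Fin Q) S).apply_symm_apply r)
  have hres2 : ∀ r, (fun p : {p // p ∉ S} => (splitEquiv (Fin Q) S).symm r p) = r.2 := fun r =>
    congrArg Prod.snd ((splitEquiv (Fin Q) S).apply_symm_apply r)
  have h1 : (∀ i, i ∉ S → (splitEquiv (Fin Q) S).symm r i = (splitEquiv (Fin Q) S).symm s i) ↔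
      s.2 = r.2 := by
    rw [← hres2 r, ← hres2 s, funext_iff, Subtype.forall]
    exact forall₂_congr fun _ _ => eq_comm
  unfold onSubset
  simp only [h1, hres, matrixUnit, ite_and]

/-- Matrix units turn the distance condition into a condition on partial-trace entries. The factor
on the left counts the redundant coordinates on `S` in the sum on the right. -/
theorem card_mul_inner_onSubset (S : Finset (Fin n)) (x x' : Fin n → Fin Q) (φ ψ : Qudits Q n) :
    (Fintype.card (S → Fin Q) : ℂ) *
        inner ℂ φ (Matrix.toEuclideanLin (onSubset S (matrixUnit S x x')) ψ) =
      ∑ y, conj (φ (S.piecewise x y)) * ψ (S.piecewise x' y) := by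
  rw [PiLp.inner_apply]
  simp only [RCLike.inner_apply, Matrix.toLpLin_apply, Matrix.mulVec, dotProduct]
  rw [← (splitEquiv (Fin Q) S).symm.sum_comp, ← (splitEquiv (Fin Q) S).symm.sum_comp]
  simp only [Fintype.sum_prod_type, piecewise_splitEquiv_symm_right]
  rw [Finset.sum_const, Finset.card_univ, nsmul_eq_mul]
  congr 1
  have h : ∀ r : (S → Fin Q) × ({p // p ∉ S} → Fin Q),
      ∑ y, onSubset S (matrixUnit S x x') ((splitEquiv _ S).symm r) y * ψ y =
        if r.1 = (fun p : S => x p) then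
          ψ ((splitEquiv _ S).symm (fun p => x' p, r.2)) else 0 := by
    intro r
    rw [← (splitEquiv (Fin Q) S).symm.sum_comp, Fintype.sum_prod_type, Finset.sum_comm]
    simp only [onSubset_matrixUnit_splitEquiv_symm]
    simp [ite_mul]
  simp only [h]
  rw [Finset.sum_comm]
  refine Finset.sum_congr rfl fun b _ => ?_
  simp [mul_comm]

theorem trace_onSubset_matrixUnit (S : Finset (Fin n)) (x x' : Fin n → Fin Q) :
    (onSubset S (matrixUnit S x x')).trace = if ∀ p ∈ S, x p = x' p then
      (Fintype.card ({p // p ∉ S} → Fin Q) : ℂ) else 0 := by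
  rw [Matrix.trace, ← (splitEquiv (Fin Q) S).symm.sum_comp, Fintype.sum_prod_type, Finset.sum_comm]
  simp only [Matrix.diag, onSubset_matrixUnit_splitEquiv_symm]
  have : (∀ p ∈ S, x p = x' p) ↔ (fun p : S => x p) = fun p => x' p.1 := by
    rw [funext_iff, Subtype.forall]
  simp only [this]
  by_cases h : (fun p : S => x p) = fun p => x' p.1 <;> simp [h]

theorem Uncorrelated.of_hasDistance {I : Type*} [DecidableEq I] {f : I → Qudits Q n}
    {S : Finset (Fin n)} (h : ∀ G : Matrix (S → Fin Q) (S → Fin Q) ℂ, ∃ c : ℂ, ∀ i j,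
      inner ℂ (f i) (Matrix.toEuclideanLin (onSubset S G) (f j)) = if i = j then c else 0) :
    Uncorrelated (fun i x => f i x) S := by
  choose c hc using h
  refine ⟨fun x x' => Fintype.card (S → Fin Q) * c (matrixUnit S x x'), fun i x x' => ?_,
    fun i j x x' hij => ?_⟩
  · rw [← card_mul_inner_onSubset, hc, if_pos rfl]
  · rw [← card_mul_inner_onSubset, hc, if_neg hij, mul_zero]

theorem sum_conj_mul_self_of_norm_eq_one {φ : Qudits Q n} (h : ‖φ‖ = 1) :
    ∑ x, conj (φ x) * φ x = 1 := by
  have h1 : inner ℂ φ φ = (1 : ℂ) := by rw [inner_self_eq_norm_sq_to_K, h]; simp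
  rw [← h1, PiLp.inner_apply]
  exact Finset.sum_congr rfl fun x _ => by rw [RCLike.inner_apply, mul_comm]

/-- Quantum MDS codes are pure: a basis of the code is maximally mixed on every set of
`t = (n + k) / 2` qudits. -/
theorem IsQuantumMDS.exists_maxMixed {t : ℕ} (hQ : 2 ≤ Q) (htn : t < n) (hn : n ≤ 2 * t)
    {C : Submodule ℂ (Qudits Q n)} (hC : IsQuantumMDS (2 * t - n) C) :
    ∃ f : Fin (Q ^ (2 * t - n)) → Qudits Q n, (∀ i, f i ∈ C) ∧
      (∀ φ ∈ C, ∃ a : Fin (Q ^ (2 * t - n)) → ℂ, φ = ∑ i, a i • f i) ∧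
      ∀ S : Finset (Fin n), S.card = t → MaxMixed (fun i x => f i x) S := by
  obtain ⟨hK, D, ⟨hD1, hD2⟩, hD⟩ := hC
  have hDt : n - t < D := by omega
  have : Nonempty (Fin Q) := ⟨⟨0, by omega⟩⟩
  rw [← hK]
  -- For `2t = n` the set `U` would be empty and could not contain a given qudit; there the trace
  -- form of the distance condition applies directly, since `t = n - t < D`.
  by_cases hk : 2 * t - n = 0
  · have hK1 : Module.finrank ℂ C = 1 := by rw [hK, hk, pow_zero]
    have b := stdOrthonormalBasis ℂ C
    have hsum : ∀ i, ∑ x, conj ((b i : Qudits Q n) x) * (b i : Qudits Q n) x = 1 := fun i =>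
      sum_conj_mul_self_of_norm_eq_one (b.orthonormal.1 i)
    refine ⟨fun i => b i, fun i => (b i).2, fun φ hφ => ⟨fun i => b.repr ⟨φ, hφ⟩ i, ?_⟩, ?_⟩
    · have := congrArg Subtype.val (b.sum_repr ⟨φ, hφ⟩)
      simpa using this.symm
    · intro S hS
      have hSD : S.card < D := by omega
      have key : ∀ x x', reduced (fun i x => (b i : Qudits Q n) x) S x x' =
          if ∀ p ∈ S, x p = x' p then (Fintype.card (Fin (Module.finrank ℂ C)) : ℂ) else 0 := by
        intro x x'
        have h1 : ∀ i, ∑ y, (b i : Qudits Q n) (S.piecewise x y) *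
            conj ((b i : Qudits Q n) (S.piecewise x' y)) =
            if ∀ p ∈ S, x p = x' p then 1 else 0 := by
          intro i
          have h2 := hD2 hK1 (b i) (b i).2 (b.orthonormal.1 i) S hSD
            (matrixUnit S x' x)
          simp only [mul_comm ((b i : Qudits Q n) _)]
          rw [← card_mul_inner_onSubset, h2, trace_onSubset_matrixUnit]
          have hQ0 : (Q : ℂ) ≠ 0 := by exact_mod_cast (by omega : Q ≠ 0)
          have hcc : ((Fintype.card (S → Fin Q) : ℕ) : ℂ) *
              ((Fintype.card ({p // p ∉ S} → Fin Q) : ℕ) : ℂ) = (Q : ℂ) ^ n := by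
            rw [← Nat.cast_mul, ← Fintype.card_prod, ← Fintype.card_congr (splitEquiv (Fin Q) S)]
            simp
          have hsymm : (∀ p ∈ S, x' p = x p) ↔ ∀ p ∈ S, x p = x' p :=
            forall₂_congr fun _ _ => eq_comm
          simp only [hsymm]
          split_ifs
          · rw [mul_left_comm, hcc, inv_mul_cancel₀ (pow_ne_zero _ hQ0)]
          · simp
        rw [reduced, Finset.sum_congr rfl fun i _ => h1 i]
        split_ifs <;> simp
      exact ⟨fun x x' h => by rw [key, if_pos h], fun x x' h => by rw [key, if_neg h]⟩
  · have hK1 : 1 < Module.finrank ℂ C := by rw [hK]; exact Nat.one_lt_pow hk (by omega)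
    obtain ⟨b, hb⟩ := hD1 hK1
    refine ⟨fun i => b i, fun i => (b i).2, fun φ hφ => ⟨fun i => b.repr ⟨φ, hφ⟩ i, ?_⟩, ?_⟩
    · have := congrArg Subtype.val (b.sum_repr ⟨φ, hφ⟩)
      simpa using this.symm
    · intro T hT
      refine maxMixed_of_forall_uncorrelated _ (fun i =>
        sum_conj_mul_self_of_norm_eq_one (b.orthonormal.1 i)) fun k hk' => ?_
      -- With `|U| = 2t - n`, the system `U` has the dimension of the code, and both `Tᶜ` and `T \
      -- U` have `n - t < D` elements.
      obtain ⟨U, hkU, hUT, hU⟩ := Finset.exists_subsuperset_card_eq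
        (Finset.singleton_subset_iff.2 hk') (n := 2 * t - n) (by simp; omega) (by omega)
      refine ⟨U, hUT, hkU (Finset.mem_singleton_self k), ?_, ?_, ?_⟩
      · rw [Fintype.card_fin, hK]
        simp [hU]
      · refine Uncorrelated.of_hasDistance (hb _ ?_)
        rw [Finset.card_compl, Fintype.card_fin]; omega
      · refine Uncorrelated.of_hasDistance (hb _ ?_)
        rw [Finset.card_sdiff_of_subset hUT]; omega

end Codes

/-! ### Counting terms in the operator decomposition of a recovery. -/

section Schmidt

variable {W κ I J Z S U : Type*} [Fintype W] [Fintype κ] [Fintype I] [Fintype J]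

/-- A family of operators with fewer than `|J|²` distinct members has a nontrivial annihilator. -/
theorem exists_annihilator (lab : W → κ) (A : W → J → J → ℂ)
    (hlab : ∀ w w', lab w = lab w' → A w = A w') (hκ : Fintype.card κ < Fintype.card J ^ 2) :
    ∃ X : J → J → ℂ, X ≠ 0 ∧ ∀ w, ∑ a', ∑ a, X a' a * A w a' a = 0 := by
  classical
  obtain ⟨B, hB⟩ : ∃ B : κ → J → J → ℂ, ∀ w, A w = B (lab w) := by
    refine ⟨fun k => if h : ∃ w, lab w = k then A h.choose else 0, fun w => ?_⟩
    have h : ∃ w', lab w' = lab w := ⟨w, rfl⟩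
    change A w = dite _ _ _
    rw [dif_pos h]
    exact hlab _ _ h.choose_spec.symm
  let L : (J × J → ℂ) →ₗ[ℂ] (κ → ℂ) :=
    (Matrix.of fun k (r : J × J) => B k r.1 r.2).mulVecLin
  have hL : L.ker ≠ ⊥ := by
    apply LinearMap.ker_ne_bot_of_finrank_lt
    simpa [sq] using hκ
  obtain ⟨X, hX, hX0⟩ := Submodule.exists_mem_ne_zero_of_ne_bot hL
  refine ⟨fun a' a => X (a', a), fun h => hX0 ?_, fun w => ?_⟩
  · ext r; exact congrFun (congrFun h r.1) r.2
  · have := congrFun (LinearMap.mem_ker.1 hX) (lab w)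
    simp only [L, Matrix.mulVecLin_apply, Matrix.mulVec, dotProduct, Matrix.of_apply,
      Fintype.sum_prod_type] at this
    rw [hB]
    simpa [mul_comm] using this

variable [Fintype Z] [Fintype S] [Fintype U] [DecidableEq I] [DecidableEq J] [DecidableEq Z]
  [DecidableEq S] [DecidableEq U]

/-- Pairwise orthogonal nonzero rows are linearly independent: pair the relation with one row. -/
theorem eq_zero_of_sum_mul_eq_zero {X Y : Type*} [Fintype X] [DecidableEq X] [Fintype Y]
    (M : X → Y → ℂ) {c : ℂ} (hc : c ≠ 0)
    (hM : ∀ x x', ∑ y, M x y * conj (M x' y) = if x = x' then c else 0)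
    {g : X → ℂ} (hg : ∀ y, ∑ x, g x * M x y = 0) : g = 0 := by
  ext x'
  have h : ∑ y, (∑ x, g x * M x y) * conj (M x' y) = g x' * c := by
    simp only [Finset.sum_mul]
    rw [Finset.sum_comm]
    simp only [mul_assoc, ← Finset.mul_sum, hM]
    simp
  simp only [hg, zero_mul, Finset.sum_const_zero] at h
  exact (mul_eq_zero.1 h.symm).resolve_right hc

/-- A bound on the number of terms of a decomposition of an operator that maps `f i` with the
system `Z` inaccessible to `f i` with the system `Z` accessible. -/
theorem card_sq_le_of_recovery [Nonempty I] [Nonempty J] (f : I → J → Z → S → U → ℂ) (c₁ c₂ c₃ : ℂ)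
    (h₂ : c₂ ≠ 0) (h₃ : c₃ ≠ 0)
    (hJS : ∀ a a' s s', ∑ i, ∑ z, ∑ u, f i a z s u * conj (f i a' z s' u) =
      if a = a' ∧ s = s' then c₁ else 0)
    (hZS : ∀ i j a a' u u', ∑ z, ∑ s, f i a z s u * conj (f j a' z s u') =
      if i = j ∧ a = a' ∧ u = u' then c₂ else 0)
    (hJZ : ∀ a a' z z', ∑ i, ∑ s, ∑ u, f i a z s u * conj (f i a' z' s u) =
      if a = a' ∧ z = z' then c₃ else 0)
    (lab : W → κ) (A : W → J → J → ℂ) (hlab : ∀ w w', lab w = lab w' → A w = A w')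
    (B : W → Z → S → S → ℂ) (D : U → U → ℂ) (ε : Z → ℂ) (hε : ε ≠ 0)
    (hrec : ∀ i a' z' s' u' z, ∑ w, ∑ a, ∑ s, ∑ u, A w a' a * B w z' s' s * D u' u * f i a z s u =
      f i a' z' s' u' * ε z) :
    Fintype.card J ^ 2 ≤ Fintype.card κ := by
  by_contra hlt
  obtain ⟨X, hX0, hX⟩ := exists_annihilator lab A hlab (not_le.1 hlt)
  obtain ⟨z₀, hz₀⟩ : ∃ z, ε z ≠ 0 := by
    by_contra! h
    exact hε (funext h)
  -- By `hZS` the vectors indexed by `(i, a, u)` in the space of `Z ⊗ S` are linearly independent.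
  have hind : ∀ g : I → J → U → ℂ, (∀ z s, ∑ i, ∑ a, ∑ u, g i a u * f i a z s u = 0) → g = 0 := by
    intro g hg
    have := eq_zero_of_sum_mul_eq_zero (fun (r : I × J × U) (y : Z × S) => f r.1 r.2.1 y.1 y.2 r.2.2)
      h₂ (by
        rintro ⟨i, a, u⟩ ⟨j, a', u'⟩
        simp only [Fintype.sum_prod_type, hZS, Prod.mk.injEq]) (g := fun r => g r.1 r.2.1 r.2.2)
      (by
        rintro ⟨z, s⟩
        simp only [Fintype.sum_prod_type, hg])
    ext i a u
    exact congrFun this (i, a, u)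
  -- `D` is invertible
  have hDker : ∀ v : U → ℂ, (∀ u, ∑ u', v u' * D u' u = 0) → v = 0 := by
    intro v hv
    obtain ⟨i₀⟩ := ‹Nonempty I›
    obtain ⟨a₀⟩ := ‹Nonempty J›
    have := hind (fun i a u => if i = i₀ ∧ a = a₀ then v u else 0) fun z s => by
      have h1 : ∑ u', v u' * (f i₀ a₀ z s u' * ε z₀) = 0 := by
        simp only [← hrec, Finset.mul_sum]
        rw [Finset.sum_comm]
        refine Finset.sum_eq_zero fun w _ => ?_
        rw [Finset.sum_comm]
        refine Finset.sum_eq_zero fun a _ => ?_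
        rw [Finset.sum_comm]
        refine Finset.sum_eq_zero fun s' _ => ?_
        rw [Finset.sum_comm]
        refine Finset.sum_eq_zero fun u _ => ?_
        calc _ = A w a₀ a * B w z s s' * f i₀ a z₀ s' u * ∑ u', v u' * D u' u := by
              rw [Finset.mul_sum]
              exact Finset.sum_congr rfl fun _ _ => by ring
          _ = 0 := by rw [hv, mul_zero]
      simp only [← mul_assoc, ← Finset.sum_mul] at h1
      have h2 := (mul_eq_zero.1 h1).resolve_right hz₀
      simpa [ite_and, ite_mul] using h2
    ext u
    simpa using congrFun (congrFun (congrFun this i₀) a₀) u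
  have hDinv : IsUnit (Matrix.of D) := by
    rw [← Matrix.vecMul_injective_iff_isUnit]
    intro v v' hvv
    rw [← sub_eq_zero]
    apply hDker
    intro u
    have := congrFun hvv u
    simp only [Matrix.vecMul, dotProduct, Matrix.of_apply] at this
    simp only [Pi.sub_apply, sub_mul, Finset.sum_sub_distrib, this, sub_self]
  obtain ⟨E, hED⟩ : ∃ E : U → U → ℂ,
      ∀ v u, ∑ u', E v u' * D u' u = if v = u then 1 else 0 := by
    obtain ⟨M, hM⟩ := hDinv.exists_left_inv
    refine ⟨M, fun v u => ?_⟩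
    have := congrFun (congrFun hM v) u
    simpa [Matrix.mul_apply, Matrix.one_apply] using this
  -- The recovery equation multiplied by `E`, the inverse of `D`.
  have hrec' : ∀ i a' z' s' z v, ∑ w, ∑ a, ∑ s, A w a' a * B w z' s' s * f i a z s v =
      ∑ u', E v u' * (f i a' z' s' u' * ε z) := by
    intro i a' z' s' z v
    simp only [← hrec, Finset.mul_sum]
    symm
    rw [Finset.sum_comm]
    refine Finset.sum_congr rfl fun w _ => ?_
    rw [Finset.sum_comm]
    refine Finset.sum_congr rfl fun a _ => ?_
    rw [Finset.sum_comm]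
    refine Finset.sum_congr rfl fun s _ => ?_
    rw [Finset.sum_comm]
    symm
    calc _ = ∑ u, A w a' a * B w z' s' s * f i a z s u * ∑ u', E v u' * D u' u := by
          simp only [hED]; simp
      _ = _ := by
          simp only [Finset.mul_sum]
          exact Finset.sum_congr rfl fun _ _ => Finset.sum_congr rfl fun _ _ => by ring
  -- the operator is determined
  have hF : ∀ a' z' s' a₂ s₂, c₁ * ∑ w, A w a' a₂ * B w z' s' s₂ =
      ∑ i, ∑ u', (∑ z, ∑ v, E v u' * ε z * conj (f i a₂ z s₂ v)) * f i a' z' s' u' := by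
    intro a' z' s' a₂ s₂
    -- By `hJS`, contracting with the conjugate of `f` over `I`, `Z` and `U` isolates a single
    -- coefficient of `∑ A ⊗ B`.
    calc _ = ∑ w, ∑ a, ∑ s, A w a' a * B w z' s' s *
          ∑ i, ∑ z, ∑ v, f i a z s v * conj (f i a₂ z s₂ v) := by
          simp only [hJS, ite_and]
          simp [Finset.mul_sum, mul_comm]
      _ = ∑ i, ∑ z, ∑ v, (∑ w, ∑ a, ∑ s, A w a' a * B w z' s' s * f i a z s v) *
          conj (f i a₂ z s₂ v) := by
          simp only [Finset.mul_sum, Finset.sum_mul]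
          have comm : ∀ g : W × J × S → I × Z × U → ℂ, ∑ r, ∑ q, g r q = ∑ q, ∑ r, g r q :=
            fun g => Finset.sum_comm
          have := comm fun r q => A r.1 a' r.2.1 * B r.1 z' s' r.2.2 *
            (f q.1 r.2.1 q.2.1 r.2.2 q.2.2 * conj (f q.1 a₂ q.2.1 s₂ q.2.2))
          simp only [Fintype.sum_prod_type] at this
          rw [this]
          simp only [mul_assoc]
      _ = _ := by
          simp only [hrec', Finset.sum_mul]
          refine Finset.sum_congr rfl fun i _ => ?_
          have comm : ∀ g : Z × U → U → ℂ, ∑ r, ∑ q, g r q = ∑ q, ∑ r, g r q :=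
            fun g => Finset.sum_comm
          have := comm fun r q => E r.2 q * (f i a' z' s' q * ε r.1) * conj (f i a₂ r.1 s₂ r.2)
          simp only [Fintype.sum_prod_type] at this
          rw [this]
          refine Finset.sum_congr rfl fun _ _ => Finset.sum_congr rfl fun _ _ =>
            Finset.sum_congr rfl fun _ _ => by ring
  -- Pairing the `J` indices of the determined operator with `X` gives zero; `hind` then strips off
  -- the factor `f i a' z' s' u'`.
  have hzero : ∀ s₂, (fun (i : I) (a' : J) (u' : U) =>
      ∑ a₂, X a' a₂ * ∑ z, ∑ v, E v u' * ε z * conj (f i a₂ z s₂ v)) = 0 := by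
    intro s₂
    apply hind
    intro z' s'
    have h1 : ∑ a', ∑ a₂, X a' a₂ * (c₁ * ∑ w, A w a' a₂ * B w z' s' s₂) = 0 := by
      have comm : ∀ g : J × J → W → ℂ, ∑ r, ∑ q, g r q = ∑ q, ∑ r, g r q :=
        fun g => Finset.sum_comm
      have := comm fun r w => X r.1 r.2 * (c₁ * (A w r.1 r.2 * B w z' s' s₂))
      simp only [Fintype.sum_prod_type] at this
      simp only [Finset.mul_sum]
      rw [this]
      refine Finset.sum_eq_zero fun w _ => ?_
      calc _ = c₁ * B w z' s' s₂ * ∑ a', ∑ a, X a' a * A w a' a := by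
            simp only [Finset.mul_sum]
            exact Finset.sum_congr rfl fun _ _ => Finset.sum_congr rfl fun _ _ => by ring
        _ = 0 := by rw [hX, mul_zero]
    simp only [hF] at h1
    obtain ⟨G, hG⟩ : ∃ G : I → U → J → ℂ, ∀ i u' a₂,
      G i u' a₂ = ∑ z, ∑ v, E v u' * ε z * conj (f i a₂ z s₂ v) := ⟨_, fun _ _ _ => rfl⟩
    simp only [← hG] at h1 ⊢
    rw [← h1, Finset.sum_comm]
    refine Finset.sum_congr rfl fun a' _ => ?_
    simp only [Finset.mul_sum, Finset.sum_mul]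
    rw [Finset.sum_comm]
    refine Eq.trans ?_ Finset.sum_comm
    rw [Finset.sum_comm]
    refine Finset.sum_congr rfl fun i _ => ?_
    rw [Finset.sum_comm]
    simp only [mul_assoc]
  -- Invertibility of `E` removes it from the relation.
  have hzero' : ∀ i a' s₂ v, ∑ a₂, ∑ z, X a' a₂ * ε z * conj (f i a₂ z s₂ v) = 0 := by
    intro i a' s₂ v
    have h0 : ∀ u', ∑ v, E v u' * ∑ a₂, ∑ z, X a' a₂ * ε z * conj (f i a₂ z s₂ v) = 0 := by
      intro u'
      refine Eq.trans ?_ (congrFun (congrFun (congrFun (hzero s₂) i) a') u')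
      simp only [Finset.mul_sum]
      rw [Finset.sum_comm]
      refine Finset.sum_congr rfl fun a₂ _ => ?_
      rw [Finset.sum_comm]
      exact Finset.sum_congr rfl fun _ _ => Finset.sum_congr rfl fun _ _ => by ring
    set g : U → ℂ := fun v => ∑ a₂, ∑ z, X a' a₂ * ε z * conj (f i a₂ z s₂ v) with hg
    calc g v = ∑ v', g v' * ∑ u', E v' u' * D u' v := by simp [hED]
      _ = ∑ u', (∑ v', E v' u' * g v') * D u' v := by
          simp only [Finset.mul_sum, Finset.sum_mul]
          rw [Finset.sum_comm]
          exact Finset.sum_congr rfl fun _ _ => Finset.sum_congr rfl fun _ _ => by ring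
      _ = 0 := by simp [hg, h0]
  apply hX0
  ext a' a₂
  -- By `hJZ` the vectors indexed by `(a, z)` are independent, so each row of `X`, tensored with
  -- `ε`, is zero; evaluating at `z₀` contradicts `X ≠ 0`.
  have := eq_zero_of_sum_mul_eq_zero (fun (r : J × Z) (y : I × S × U) => f y.1 r.1 r.2 y.2.1 y.2.2)
    h₃ (by
      rintro ⟨a, z⟩ ⟨b, z'⟩
      simp only [Fintype.sum_prod_type, hJZ, Prod.mk.injEq])
    (g := fun r => conj (X a' r.1 * ε r.2))
    (by
      rintro ⟨i, s, u⟩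
      have := congrArg conj (hzero' i a' s u)
      simpa [Fintype.sum_prod_type] using this)
  have h2 := congrFun this (a₂, z₀)
  simpa [hz₀] using h2

end Schmidt

/-! ### Branches of a protocol as tensor networks. -/

section Branches

theorem prod_sum_eq {ι : Type*} [Fintype ι] [DecidableEq ι] {X : ι → Type*} [∀ p, Fintype (X p)]
    (g : ∀ p, X p → ℂ) : ∏ p, ∑ x, g p x = ∑ x : ∀ p, X p, ∏ p, g p (x p) := by
  rw [Finset.prod_univ_sum, Fintype.piFinset_univ]

variable {Q n : ℕ} {m : Fin n → ℕ} {μ : Fin n → Fin n → ℕ}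
  {m' : Fin n → ℕ} {μ' : Fin n → Fin n → ℕ}

/-- Some outcome of a round has nonzero probability. -/
theorem exists_applyLocal_ne_zero {o : Fin n → ℕ} (K : ∀ p, Fin (o p) → LocalOp m μ m' μ' p)
    (complete : ∀ p, ∑ v, (K p v).conjTranspose * K p v = 1) {ψ : State Q m μ} (hψ : ψ ≠ 0) :
    ∃ v : ∀ p, Fin (o p), applyLocal (fun p => K p (v p)) ψ ≠ 0 := by
  by_contra! h
  apply hψ
  ext x y z
  have h1 : ∀ (v : ∀ p, Fin (o p)) (x' : ∀ p, Fin (m' p)) (y' : ∀ p q, Fin (μ' p q)), ∑ x₂ : (∀ p, Fin (m p)), ∑ y₂ : (∀ p q, Fin (μ p q)),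
      (∏ p, K p (v p) (x' p, fun q => y' p q) (x₂ p, fun q => y₂ q p)) * ψ x₂ y₂ z = 0 :=
    fun v x' y' => congrFun (congrFun (congrFun (h v) x') y') z
  -- The tensor product of the local completeness relations: summed over all outcomes, `K†K` is the
  -- identity on the joint system, so if every outcome gave zero the input would be zero.
  have h2 : ∀ x₂ y₂, ∑ v : ∀ p, Fin (o p), ∑ x' : ∀ p, Fin (m' p), ∑ y' : ∀ p q, Fin (μ' p q),
      (∏ p, conj (K p (v p) (x' p, y' p) (x p, fun q => y q p))) *
        (∏ p, K p (v p) (x' p, y' p) (x₂ p, fun q => y₂ q p)) =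
      if x = x₂ then if y = y₂ then 1 else 0 else 0 := by
    intro x₂ y₂
    simp only [← Finset.prod_mul_distrib]
    rw [← prod_sum_eq (fun p (v : Fin (o p)) => ∑ x' : Fin (m' p), ∑ y' : ∀ q, Fin (μ' p q),
      conj (K p v (x', y') (x p, fun q => y q p)) * K p v (x', y') (x₂ p, fun q => y₂ q p)) |>.trans
      (Finset.sum_congr rfl fun v _ => by
        rw [prod_sum_eq]
        exact Finset.sum_congr rfl fun x' _ => by rw [prod_sum_eq])]
    have h3 : ∀ p, ∑ v : Fin (o p), ∑ x' : Fin (m' p), ∑ y' : ∀ q, Fin (μ' p q),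
        conj (K p v (x', y') (x p, fun q => y q p)) * K p v (x', y') (x₂ p, fun q => y₂ q p) =
        if x p = x₂ p ∧ (fun q => y q p) = (fun q => y₂ q p) then 1 else 0 := by
      intro p
      have := congrFun (congrFun (complete p) (x p, fun q => y q p)) (x₂ p, fun q => y₂ q p)
      simp only [Matrix.sum_apply, Matrix.mul_apply, Matrix.conjTranspose_apply,
        Fintype.sum_prod_type, Matrix.one_apply, Prod.mk.injEq] at this
      exact this
    simp only [h3, Finset.prod_ite_zero, Finset.prod_const_one, Finset.mem_univ, true_imp_iff]
    rw [← ite_and]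
    refine if_congr ?_ rfl rfl
    simp only [forall_and, funext_iff]
    exact and_congr Iff.rfl forall_comm
  have h4 : ∑ v : ∀ p, Fin (o p), ∑ x' : ∀ p, Fin (m' p), ∑ y' : ∀ p q, Fin (μ' p q),
      (∏ p, conj (K p (v p) (x' p, y' p) (x p, fun q => y q p))) *
        ∑ x₂ : (∀ p, Fin (m p)), ∑ y₂ : (∀ p q, Fin (μ p q)),
      (∏ p, K p (v p) (x' p, fun q => y' p q) (x₂ p, fun q => y₂ q p)) * ψ x₂ y₂ z = 0 := by
    simp only [h1, mul_zero, Finset.sum_const_zero]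
  have comm : ∀ g : ((∀ p, Fin (o p)) × (∀ p, Fin (m' p)) × ∀ p q, Fin (μ' p q)) →
      ((∀ p, Fin (m p)) × ∀ p q, Fin (μ p q)) → ℂ, ∑ r, ∑ s, g r s = ∑ s, ∑ r, g r s :=
    fun g => Finset.sum_comm
  have h5 := comm fun r s => (∏ p, conj (K p (r.1 p) (r.2.1 p, r.2.2 p) (x p, fun q => y q p))) *
      ((∏ p, K p (r.1 p) (r.2.1 p, r.2.2 p) (s.1 p, fun q => s.2 q p)) * ψ s.1 s.2 z)
  simp only [Fintype.sum_prod_type] at h5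
  simp only [Finset.mul_sum] at h4
  rw [h5] at h4
  simp only [← mul_assoc, ← Finset.sum_mul, h2] at h4
  simpa [ite_mul] using h4

/-- The operator of a branch of a protocol, as a tensor network: the network has one tensor for
each party, and they are contracted along the messages. -/
def contract {W : Type} [Fintype W]
    (A : W → ∀ p, Fin Q → Fin (m p) → (∀ q, Fin (μ q p)) → ℂ) (ψ : State Q m μ) :
    State Q (fun _ : Fin n => Q) (fun _ _ => 1) :=
  fun x' _ z => ∑ x : ∀ p, Fin (m p), ∑ y : ∀ p q, Fin (μ p q),
    ∑ w, (∏ p, A w p (x' p) (x p) (fun q => y q p)) * ψ x y z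

/-- The messages of a round become additional summation labels, while its memories are contracted
inside each party's tensor. This keeps one tensor per party and drives the induction on rounds. -/
theorem contract_applyLocal {W : Type} [Fintype W]
    (A : W → ∀ p, Fin Q → Fin (m' p) → (∀ q, Fin (μ' q p)) → ℂ)
    (K : ∀ p, LocalOp m μ m' μ' p) (ψ : State Q m μ) :
    contract A (applyLocal K ψ) = contract (W := W × ∀ p q, Fin (μ' p q))
      (fun r p x'' x y => ∑ x', A r.1 p x'' x' (fun q => r.2 q p) * K p (x', r.2 p) (x, y)) ψ := by
  ext x'' y'' z
  simp only [contract, applyLocal, prod_sum_eq, Finset.sum_mul, Finset.mul_sum,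
    Finset.prod_mul_distrib]
  have comm : ∀ g : ((∀ p, Fin (m' p)) × (∀ p q, Fin (μ' p q)) × W) →
      ((∀ p, Fin (m p)) × ∀ p q, Fin (μ p q)) → ℂ, ∑ r, ∑ s, g r s = ∑ s, ∑ r, g r s :=
    fun g => Finset.sum_comm
  have h := comm fun r s => (∏ p, A r.2.2 p (x'' p) (r.1 p) (fun q => r.2.1 q p)) *
      ((∏ p, K p (r.1 p, r.2.1 p) (s.1 p, fun q => s.2 q p)) * ψ s.1 s.2 z)
  simp only [Fintype.sum_prod_type] at h
  rw [h]
  refine Finset.sum_congr rfl fun x _ => Finset.sum_congr rfl fun y _ => ?_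
  have comm2 : ∀ g : (∀ p, Fin (m' p)) → (∀ p q, Fin (μ' p q)) → W → ℂ,
      ∑ a, ∑ b, ∑ c, g a b c = ∑ c, ∑ b, ∑ a, g a b c := by
    intro g
    rw [Finset.sum_comm]
    simp only [Finset.sum_comm (f := fun a c => g a _ c)]
    exact Finset.sum_comm
  rw [comm2]
  simp only [Fintype.sum_prod_type, mul_assoc]

/-- A branch of nonzero probability. The tensor of a party whose only channel is `{j, e}` depends on
the messages over this channel only, and the tensor of a party without channels is constant. -/
theorem Protocol.exists_branch {H : SimpleGraph (Fin n)} {j e : Fin n}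
    (hj : ∀ q, H.Adj j q → q = e) (P : Protocol Q H m μ) (ψ : State Q m μ) (hψ : ψ ≠ 0) :
    ∃ (W κ : Type) (_ : Fintype W) (_ : Fintype κ) (lab : W → κ)
      (A : W → ∀ p, Fin Q → Fin (m p) → (∀ q, Fin (μ q p)) → ℂ),
      Fintype.card κ ≤ P.channelDim s(j, e) ∧
      (∀ w w', lab w = lab w' → A w j = A w' j) ∧
      (∀ u, (∀ q, ¬ H.Adj u q) → ∀ w w', A w u = A w' u) ∧
      (∀ φ, contract A φ ∈ P.finalStates φ) ∧ contract A ψ ≠ 0 := by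
  induction P with
  | done =>
    have hc : ∀ φ : State Q (fun _ : Fin n => Q) (fun _ _ => 1), contract (W := Unit)
        (fun _ _ x' x _ => if x' = x then 1 else 0) φ = φ := by
      intro φ
      ext x' y' z
      have h : ∀ x : Fin n → Fin Q, (∏ p, if x' p = x p then (1 : ℂ) else 0) =
          if x' = x then 1 else 0 := by
        intro x
        simp [Finset.prod_ite_zero, funext_iff]
      simp only [contract, h]
      simp [ite_mul, Subsingleton.elim y' default]
    refine ⟨Unit, Unit, inferInstance, inferInstance, id, fun _ _ x' x _ => if x' = x then 1 else 0,
      by simp [channelDim], fun _ _ _ => rfl, fun _ _ _ _ => rfl, fun φ => ?_, ?_⟩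
    · rw [hc]; rfl
    · rwa [hc]
  | @round m μ m' μ' channels o K complete next ih =>
    obtain ⟨v, hv⟩ := exists_applyLocal_ne_zero K complete hψ
    obtain ⟨W, κ, _, _, lab, A, hκ, hA, hu, hfin, hne⟩ := ih v _ hv
    have hsub : ∀ p q, ¬ H.Adj p q → ∀ a b : Fin (μ' p q), a = b := by
      intro p q hpq a b
      have := channels p q hpq
      exact Fin.ext (by omega)
    -- Of the new messages the label retains only the two on the channel `{j, e}`; its number of
    -- values therefore grows by the same factor as `channelDim`.
    refine ⟨W × ∀ p q, Fin (μ' p q), κ × Fin (μ' j e) × Fin (μ' e j), inferInstance, inferInstance,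
      fun r => (lab r.1, r.2 j e, r.2 e j),
      fun r p x'' x y => ∑ x', A r.1 p x'' x' (fun q => r.2 q p) * K p (v p) (x', r.2 p) (x, y),
      ?_, ?_, ?_, ?_, ?_⟩
    · simp only [channelDim, Fintype.card_prod, Fintype.card_fin, Sym2.lift_mk]
      rw [mul_comm]
      exact Nat.mul_le_mul le_rfl (hκ.trans
        (Finset.le_sup (f := fun v => (next v).channelDim s(j, e)) (Finset.mem_univ v)))
    · rintro ⟨w, y⟩ ⟨w', y'⟩ hl
      simp only [Prod.mk.injEq] at hl
      have h1 : y j = y' j := by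
        ext1 q
        by_cases hq : H.Adj j q
        · obtain rfl := hj q hq; exact hl.2.1
        · exact hsub _ _ hq _ _
      have h2 : (fun q => y q j) = fun q => y' q j := by
        ext1 q
        by_cases hq : H.Adj j q
        · obtain rfl := hj q hq; exact hl.2.2
        · exact hsub _ _ (fun h => hq h.symm) _ _
      simp only [hA w w' hl.1, h1, h2]
    · rintro u hu' ⟨w, y⟩ ⟨w', y'⟩
      have h1 : y u = y' u := funext fun q => hsub _ _ (hu' q) _ _
      have h2 : (fun q => y q u) = fun q => y' q u :=
        funext fun q => hsub _ _ (fun h => hu' q h.symm) _ _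
      simp only [hu u hu' w w', h1, h2]
    · intro φ
      rw [← contract_applyLocal]
      exact ⟨v, hfin _⟩
    · rw [← contract_applyLocal]
      exact hne

end Branches

/-! ### Coordinates adapted to the cut at one helper. -/

section LowerBound

variable {ι : Type*} [DecidableEq ι]

/-- Configurations as quadruples: the values at `j ∈ T` and `e ∉ T`, and the configurations on the
rest of `T` and on the rest of the complement. -/
def splitEquiv₄ (α : Type*) {T : Finset ι} {j e : ι} (hj : j ∈ T) (he : e ∉ T) :
    (ι → α) ≃ α × α × ({p // p ∈ T ∧ p ≠ j} → α) × ({p // p ∉ T ∧ p ≠ e} → α) where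
  toFun x := (x j, x e, fun p => x p, fun p => x p)
  invFun r p := if hT : p ∈ T then if hp : p = j then r.1 else r.2.2.1 ⟨p, hT, hp⟩ else
    if hp : p = e then r.2.1 else r.2.2.2 ⟨p, hT, hp⟩
  left_inv x := by
    ext p
    by_cases hT : p ∈ T
    · by_cases hp : p = j <;> simp [hT, hp, hj]
    · by_cases hp : p = e <;> simp [hT, hp, he]
  right_inv r := by
    refine Prod.ext ?_ (Prod.ext ?_ (Prod.ext ?_ ?_))
    · simp [hj]
    · simp [he]
    · ext ⟨p, hp⟩
      simp [hp.1, hp.2]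
    · ext ⟨p, hp⟩
      simp [hp.1, hp.2]

theorem prod_eq_prod_split [Fintype ι] {T : Finset ι} {j e : ι} (hj : j ∈ T) (he : e ∉ T) (g : ι → ℂ) :
    ∏ p, g p = g j * (g e * ∏ p : {p // p ∈ T ∧ p ≠ j}, g p) *
      ∏ p : {p // p ∉ T ∧ p ≠ e}, g p := by
  rw [← Finset.prod_mul_prod_compl T, ← Finset.mul_prod_erase T g hj,
    ← Finset.mul_prod_erase Tᶜ g (Finset.mem_compl.2 he),
    Finset.prod_subtype (T.erase j) (p := fun p => p ∈ T ∧ p ≠ j) (by simp [and_comm]),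
    Finset.prod_subtype (Tᶜ.erase e) (p := fun p => p ∉ T ∧ p ≠ e) (by simp [and_comm])]
  ring

section

variable {α : Type*} {T : Finset ι} {j e : ι} (hj : j ∈ T) (he : e ∉ T)

@[simp]
theorem splitEquiv₄_symm_left (a z : α) (s u) : (splitEquiv₄ α hj he).symm (a, z, s, u) j = a :=
  congrArg Prod.fst ((splitEquiv₄ α hj he).apply_symm_apply (a, z, s, u))

@[simp]
theorem splitEquiv₄_symm_right (a z : α) (s u) : (splitEquiv₄ α hj he).symm (a, z, s, u) e = z :=
  congrArg (fun r => r.2.1) ((splitEquiv₄ α hj he).apply_symm_apply (a, z, s, u))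

@[simp]
theorem splitEquiv₄_symm_mem (a z : α) (s u) (p : {p // p ∈ T ∧ p ≠ j}) :
    (splitEquiv₄ α hj he).symm (a, z, s, u) p = s p :=
  congrFun (congrArg (fun r => r.2.2.1) ((splitEquiv₄ α hj he).apply_symm_apply (a, z, s, u))) p

@[simp]
theorem splitEquiv₄_symm_not_mem (a z : α) (s u) (p : {p // p ∉ T ∧ p ≠ e}) :
    (splitEquiv₄ α hj he).symm (a, z, s, u) p = u p :=
  congrFun (congrArg (fun r => r.2.2.2) ((splitEquiv₄ α hj he).apply_symm_apply (a, z, s, u))) p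

theorem eq_splitEquiv₄_symm_iff (x : ι → α) (r) :
    x = (splitEquiv₄ α hj he).symm r ↔ x j = r.1 ∧ x e = r.2.1 ∧
      (∀ p : {p // p ∈ T ∧ p ≠ j}, x p = r.2.2.1 p) ∧
      ∀ p : {p // p ∉ T ∧ p ≠ e}, x p = r.2.2.2 p := by
  rw [Equiv.eq_symm_apply]
  simp only [splitEquiv₄, Equiv.coe_fn_mk, Prod.ext_iff, funext_iff]

theorem piecewise_splitEquiv₄_symm (a z a' z' : α) (s u s' u') :
    T.piecewise ((splitEquiv₄ α hj he).symm (a, z, s, u))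
      ((splitEquiv₄ α hj he).symm (a', z', s', u')) =
      (splitEquiv₄ α hj he).symm (a, z', s, u') := by
  rw [eq_splitEquiv₄_symm_iff]
  refine ⟨by simp [Finset.piecewise, hj], by simp [Finset.piecewise, he], fun p => ?_, fun p => ?_⟩
  · simp [Finset.piecewise, p.2.1]
  · simp [Finset.piecewise, p.2.1]

theorem piecewise_insert_erase_splitEquiv₄_symm (a z a' z' : α) (s u s' u') :
    (insert e (T.erase j)).piecewise ((splitEquiv₄ α hj he).symm (a, z, s, u))
      ((splitEquiv₄ α hj he).symm (a', z', s', u')) =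
      (splitEquiv₄ α hj he).symm (a', z, s, u') := by
  rw [eq_splitEquiv₄_symm_iff]
  refine ⟨by simp [Finset.piecewise, ne_of_mem_of_not_mem hj he], by simp [Finset.piecewise],
    fun p => ?_, fun p => ?_⟩
  · simp [Finset.piecewise, p.2.1, p.2.2]
  · simp [Finset.piecewise, p.2.1, p.2.2]

theorem piecewise_pair_splitEquiv₄_symm (a z a' z' : α) (s u s' u') :
    ({j, e} : Finset ι).piecewise ((splitEquiv₄ α hj he).symm (a, z, s, u))
      ((splitEquiv₄ α hj he).symm (a', z', s', u')) =
      (splitEquiv₄ α hj he).symm (a, z, s', u') := by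
  rw [eq_splitEquiv₄_symm_iff]
  refine ⟨by simp [Finset.piecewise], by simp [Finset.piecewise], fun p => ?_, fun p => ?_⟩
  · have h1 : (p : ι) ≠ e := fun h => he (h ▸ p.2.1)
    simp [Finset.piecewise, p.2.2, h1]
  · have h1 : (p : ι) ≠ j := fun h => p.2.1 (h ▸ hj)
    simp [Finset.piecewise, p.2.2, h1]

theorem update_splitEquiv₄_symm (a z z' : α) (s u) :
    Function.update ((splitEquiv₄ α hj he).symm (a, z, s, u)) e z' =
      (splitEquiv₄ α hj he).symm (a, z', s, u) := by
  rw [eq_splitEquiv₄_symm_iff]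
  refine ⟨by simp [ne_of_mem_of_not_mem hj he], by simp, fun p => ?_, fun p => ?_⟩
  · have h1 : (p : ι) ≠ e := fun h => he (h ▸ p.2.1)
    simp [h1]
  · simp [p.2.2]

variable {I : Type*} [Fintype ι] [Fintype α] [Nonempty α]

/-- Supplies `hJS` of `card_sq_le_of_recovery`. The inverse factor removes the redundant summation
over the coordinates on `T`. -/
theorem MaxMixed.sum_splitEquiv₄ [Fintype I] [DecidableEq α] {f : I → (ι → α) → ℂ}
    (h : MaxMixed f T) (a a' : α) (s s' : {p // p ∈ T ∧ p ≠ j} → α) :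
    ∑ i, ∑ z, ∑ u, f i ((splitEquiv₄ α hj he).symm (a, z, s, u)) *
        conj (f i ((splitEquiv₄ α hj he).symm (a', z, s', u))) =
      if a = a' ∧ s = s' then ((Fintype.card α : ℂ) *
        (Fintype.card ({p // p ∈ T ∧ p ≠ j} → α) : ℂ))⁻¹ * Fintype.card I else 0 := by
  obtain ⟨z₀⟩ := ‹Nonempty α›
  have hc : (Fintype.card α : ℂ) * (Fintype.card ({p // p ∈ T ∧ p ≠ j} → α) : ℂ) ≠ 0 := by
    have : Nonempty α := ⟨z₀⟩
    exact mul_ne_zero (by exact_mod_cast Fintype.card_ne_zero)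
      (by exact_mod_cast Fintype.card_ne_zero)
  set x := (splitEquiv₄ α hj he).symm (a, z₀, s, fun _ => z₀) with hx
  set x' := (splitEquiv₄ α hj he).symm (a', z₀, s', fun _ => z₀) with hx'
  have hred : reduced f T x x' = ((Fintype.card α : ℂ) *
      (Fintype.card ({p // p ∈ T ∧ p ≠ j} → α) : ℂ)) *
      ∑ i, ∑ z, ∑ u, f i ((splitEquiv₄ α hj he).symm (a, z, s, u)) *
        conj (f i ((splitEquiv₄ α hj he).symm (a', z, s', u))) := by
    rw [reduced, Finset.mul_sum]
    refine Finset.sum_congr rfl fun i _ => ?_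
    rw [← (splitEquiv₄ α hj he).symm.sum_comp]
    simp only [Fintype.sum_prod_type, hx, hx', piecewise_splitEquiv₄_symm]
    simp only [Finset.sum_const, Finset.card_univ, nsmul_eq_mul, Finset.mul_sum, mul_assoc]
  have hag : (∀ p ∈ T, x p = x' p) ↔ a = a' ∧ s = s' := by
    constructor
    · intro h1
      refine ⟨by simpa [hx, hx'] using h1 j hj, funext fun p => ?_⟩
      simpa only [hx, hx', splitEquiv₄_symm_mem] using h1 p p.2.1
    · rintro ⟨rfl, rfl⟩
      simp [hx, hx']
  split_ifs with has
  · rw [← h.1 x x' (hag.2 has), hred, inv_mul_cancel_left₀ hc]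
  · rw [h.2 x x' fun h1 => has (hag.1 h1)] at hred
    exact (mul_eq_zero.1 hred.symm).resolve_left hc

/-- Supplies `hZS`: the cut puts `e` and `T \ {j}` on one side, so the index, the value at `j` and
the outside values label orthogonal vectors. -/
theorem Isometric.sum_splitEquiv₄ [DecidableEq α] [DecidableEq I] {f : I → (ι → α) → ℂ}
    (h : Isometric f (insert e (T.erase j))) (i i' : I) (a a' : α)
    (u u' : {p // p ∉ T ∧ p ≠ e} → α) :
    ∑ z, ∑ s, f i ((splitEquiv₄ α hj he).symm (a, z, s, u)) *
        conj (f i' ((splitEquiv₄ α hj he).symm (a', z, s, u'))) =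
      if i = i' ∧ a = a' ∧ u = u' then ((Fintype.card α : ℂ) *
        (Fintype.card ({p // p ∉ T ∧ p ≠ e} → α) : ℂ))⁻¹ else 0 := by
  obtain ⟨z₀⟩ := ‹Nonempty α›
  have hc : (Fintype.card α : ℂ) * (Fintype.card ({p // p ∉ T ∧ p ≠ e} → α) : ℂ) ≠ 0 := by
    have : Nonempty α := ⟨z₀⟩
    exact mul_ne_zero (by exact_mod_cast Fintype.card_ne_zero)
      (by exact_mod_cast Fintype.card_ne_zero)
  set y := (splitEquiv₄ α hj he).symm (a, z₀, fun _ => z₀, u) with hy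
  set y' := (splitEquiv₄ α hj he).symm (a', z₀, fun _ => z₀, u') with hy'
  have hred : ∑ x, conj (f i' ((insert e (T.erase j)).piecewise x y')) *
      f i ((insert e (T.erase j)).piecewise x y) = ((Fintype.card α : ℂ) *
      (Fintype.card ({p // p ∉ T ∧ p ≠ e} → α) : ℂ)) *
      ∑ z, ∑ s, f i ((splitEquiv₄ α hj he).symm (a, z, s, u)) *
        conj (f i' ((splitEquiv₄ α hj he).symm (a', z, s, u'))) := by
    rw [← (splitEquiv₄ α hj he).symm.sum_comp]
    simp only [Fintype.sum_prod_type, hy, hy', piecewise_insert_erase_splitEquiv₄_symm]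
    simp only [Finset.sum_const, Finset.card_univ, nsmul_eq_mul, Finset.mul_sum, mul_assoc]
    refine Finset.sum_congr rfl fun _ _ => Finset.sum_congr rfl fun _ _ => by ring
  have hag : (∀ p, p ∉ insert e (T.erase j) → y' p = y p) ↔ a = a' ∧ u = u' := by
    constructor
    · intro h1
      refine ⟨?_, funext fun p => ?_⟩
      · have := h1 j (by simp [ne_of_mem_of_not_mem hj he])
        simpa [hy, hy'] using this.symm
      · have := h1 p (by simp [p.2.1, p.2.2])
        simpa only [hy, hy', splitEquiv₄_symm_not_mem] using this.symm
    · rintro ⟨rfl, rfl⟩ p hp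
      rfl
  split_ifs with has
  · obtain ⟨rfl, has⟩ := has
    rw [h.1 i y' y (hag.2 has)] at hred
    rw [eq_comm, inv_eq_iff_eq_inv, eq_comm, inv_eq_of_mul_eq_one_left]
    exact hred.symm
  · rw [h.2 i' i y' y fun h1 => has ⟨h1.1.symm, hag.1 h1.2⟩] at hred
    exact (mul_eq_zero.1 hred.symm).resolve_left hc

/-- Supplies `hJZ`, the only place where the reduced state on `{j, e}` is used. -/
theorem MaxMixed.sum_pair_splitEquiv₄ [Fintype I] [DecidableEq α] {f : I → (ι → α) → ℂ}
    (h : MaxMixed f {j, e}) (a a' z z' : α) :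
    ∑ i, ∑ s, ∑ u, f i ((splitEquiv₄ α hj he).symm (a, z, s, u)) *
        conj (f i ((splitEquiv₄ α hj he).symm (a', z', s, u))) =
      if a = a' ∧ z = z' then ((Fintype.card α : ℂ) * (Fintype.card α : ℂ))⁻¹ *
        Fintype.card I else 0 := by
  have hc : (Fintype.card α : ℂ) * (Fintype.card α : ℂ) ≠ 0 :=
    mul_ne_zero (by exact_mod_cast Fintype.card_ne_zero) (by exact_mod_cast Fintype.card_ne_zero)
  set x := (splitEquiv₄ α hj he).symm (a, z, fun _ => z, fun _ => z) with hx
  set x' := (splitEquiv₄ α hj he).symm (a', z', fun _ => z, fun _ => z) with hx'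
  have hred : reduced f {j, e} x x' = ((Fintype.card α : ℂ) * (Fintype.card α : ℂ)) *
      ∑ i, ∑ s, ∑ u, f i ((splitEquiv₄ α hj he).symm (a, z, s, u)) *
        conj (f i ((splitEquiv₄ α hj he).symm (a', z', s, u))) := by
    rw [reduced, Finset.mul_sum]
    refine Finset.sum_congr rfl fun i _ => ?_
    rw [← (splitEquiv₄ α hj he).symm.sum_comp]
    simp only [Fintype.sum_prod_type, hx, hx', piecewise_pair_splitEquiv₄_symm]
    simp only [Finset.sum_const, Finset.card_univ, nsmul_eq_mul, mul_assoc]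
  have hag : (∀ p ∈ ({j, e} : Finset ι), x p = x' p) ↔ a = a' ∧ z = z' := by
    simp [hx, hx']
  split_ifs with has
  · rw [← h.1 x x' (hag.2 has), hred, inv_mul_cancel_left₀ hc]
  · rw [h.2 x x' fun h1 => has (hag.1 h1)] at hred
    exact (mul_eq_zero.1 hred.symm).resolve_left hc

end

end LowerBound

/-! ### The lower bound for each channel and for the cost. -/

section CutBound

variable {Q n : ℕ}

theorem erasedState_ne_zero (hQ : 0 < Q) (e : Fin n) {φ : Qudits Q n} (hφ : φ ≠ 0) :
    erasedState e φ ≠ 0 := by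
  obtain ⟨x, hx⟩ : ∃ x, φ x ≠ 0 := by
    by_contra! h
    exact hφ (by ext x; exact h x)
  intro h
  have := congrFun (congrFun (congrFun h (Function.update x e ⟨0, hQ⟩)) fun _ _ => 0) (x e)
  simp [erasedState] at this
  exact hx this

/-- Linearity is what forces the residual state `ε` to be the same for all basis vectors of the
code. -/
theorem contract_erasedState_add {W : Type} [Fintype W]
    (A : W → Fin n → Fin Q → Fin Q → (Fin n → Fin 1) → ℂ) (e : Fin n) (φ φ' : Qudits Q n) :
    contract (m := fun _ => Q) (μ := fun _ _ => 1) A (erasedState e (φ + φ')) =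
      contract (m := fun _ => Q) (μ := fun _ _ => 1) A (erasedState e φ) +
        contract (m := fun _ => Q) (μ := fun _ _ => 1) A (erasedState e φ') := by
  have h : ∀ x y z, erasedState e (φ + φ') x y z = erasedState e φ x y z + erasedState e φ' x y z := by
    intro x y z
    simp only [erasedState]
    split_ifs <;> simp
  ext x y z
  simp only [contract, h, mul_add, Finset.sum_add_distrib, Pi.add_apply]

/-- The messages of a round in which nothing is sent. -/
abbrev noMessage : ∀ _ : Fin n, Fin 1 := fun _ => 0

/-- The replacement node starts in `|0⟩`, so only one input value of its tensor survives, and the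
index `z` of the erased qudit enters through `φ` alone. -/
theorem contract_erasedState_splitEquiv₄ (hQ : 0 < Q) {W : Type} [Fintype W]
    (A : W → Fin n → Fin Q → Fin Q → (Fin n → Fin 1) → ℂ) {T : Finset (Fin n)} {j e : Fin n}
    (hj : j ∈ T) (he : e ∉ T) (φ : Qudits Q n) (a' z') (s' u') (y z) :
    contract (m := fun _ => Q) (μ := fun _ _ => 1) A (erasedState e φ)
        ((splitEquiv₄ (Fin Q) hj he).symm (a', z', s', u')) y z =
      ∑ w, ∑ a, ∑ s, ∑ u, A w j a' a noMessage *
        (A w e z' ⟨0, hQ⟩ noMessage *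
          ∏ p : {p // p ∈ T ∧ p ≠ j}, A w p (s' p) (s p) noMessage) *
        (∏ p : {p // p ∉ T ∧ p ≠ e}, A w p (u' p) (u p) noMessage) *
        φ ((splitEquiv₄ (Fin Q) hj he).symm (a, z, s, u)) := by
  have hy : ∀ (y : ∀ _ _ : Fin n, Fin 1) p, (fun q => y q p) = noMessage := fun y p =>
    Subsingleton.elim _ _
  simp only [contract, hy]
  simp only [Finset.univ_unique, Finset.sum_singleton]
  rw [← (splitEquiv₄ (Fin Q) hj he).symm.sum_comp, Finset.sum_comm]
  refine Finset.sum_congr rfl fun w _ => ?_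
  rw [Fintype.sum_prod_type]
  refine Finset.sum_congr rfl fun a _ => ?_
  rw [Fintype.sum_prod_type, Finset.sum_eq_single ⟨0, hQ⟩]
  · rw [Fintype.sum_prod_type]
    refine Finset.sum_congr rfl fun s _ => Finset.sum_congr rfl fun u _ => ?_
    rw [prod_eq_prod_split hj he]
    simp [erasedState, update_splitEquiv₄_symm]
  · intro zz _ hzz
    refine Finset.sum_eq_zero fun ⟨s, u⟩ _ => ?_
    have : (zz : ℕ) ≠ 0 := fun h => hzz (Fin.ext h)
    simp [erasedState, this]
  · simp

/-- The dimension count is `t = (2t - n) + (n - t)`. -/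
theorem isometric_of_maxMixed [NeZero Q] {t : ℕ} (htn : t < n) (hn : n ≤ 2 * t)
    {f : Fin (Q ^ (2 * t - n)) → (Fin n → Fin Q) → ℂ} {S : Finset (Fin n)} (h : MaxMixed f S)
    (hS : S.card = t) : Isometric f S := by
  have : Nonempty (Fin (Q ^ (2 * t - n))) := ⟨⟨0, pow_pos (NeZero.pos Q) _⟩⟩
  refine h.isometric ?_
  simp only [Fintype.card_fun, Fintype.card_fin, Fintype.card_coe, Fintype.card_subtype_compl, hS]
  rw [← pow_add]
  congr 1
  omega

/-- The channel between a helper node and the hub carries dimension at least `Q ^ 2`. -/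
theorem sq_le_channelDim {t : ℕ} (hQ : 2 ≤ Q) (ht : 1 < t) (htn : t < n) (hn : n ≤ 2 * t)
    {C : Submodule ℂ (Qudits Q n)} (hC : IsQuantumMDS (2 * t - n) C) {e j : Fin n}
    {T : Finset (Fin n)} (he : e ∉ T) (hT : T.card = t) (hj : j ∈ T)
    (P : StorageProtocol Q (starNetwork e T)) (hP : Corrects C e P) :
    Q ^ 2 ≤ P.channelDim s(j, e) := by
  have hQ0 : 0 < Q := by omega
  have : NeZero Q := ⟨hQ0.ne'⟩
  have hje : j ≠ e := ne_of_mem_of_not_mem hj he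
  obtain ⟨f, hfC, -, hmix⟩ := hC.exists_maxMixed hQ htn hn
  have hI : Nonempty (Fin (Q ^ (2 * t - n))) := ⟨⟨0, by positivity⟩⟩
  have hiso : ∀ S : Finset (Fin n), S.card = t → Isometric (fun i x => f i x) S := fun S hS =>
    isometric_of_maxMixed htn hn (hmix S hS) hS
  have horth : ∀ i i', ∑ x, conj (f i x) * f i' x = if i = i' then 1 else 0 := by
    intro i i'
    have h := (hiso T hT).mono (Finset.subset_univ T)
    split_ifs with hii
    · subst hii
      have := h.1 i (fun _ => ⟨0, hQ0⟩) (fun _ => ⟨0, hQ0⟩) (by simp)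
      simpa using this
    · have := h.2 i i' (fun _ => ⟨0, hQ0⟩) (fun _ => ⟨0, hQ0⟩) (by simp [hii])
      simpa using this
  -- Here `1 < t` is needed, to enlarge the pair to a set of `t` qudits.
  have hpair : MaxMixed (fun i x => f i x) {j, e} := by
    obtain ⟨S, hS, -, hSt⟩ := Finset.exists_subsuperset_card_eq
      (Finset.subset_univ ({j, e} : Finset (Fin n))) (n := t)
      (by rw [Finset.card_pair hje]; omega) (by simp; omega)
    exact (hmix S hSt).mono hS
  have hcardP : (insert e (T.erase j)).card = t := by
    rw [Finset.card_insert_of_notMem (by simp [he]), Finset.card_erase_of_mem hj]; omega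
  obtain ⟨i₀⟩ := id hI
  have hf0 : f i₀ ≠ 0 := by
    intro h
    have := horth i₀ i₀
    simp [h] at this
  have hadj : ∀ q, (starNetwork e T).Adj j q → q = e := by
    rintro q ⟨-, h | h⟩
    · exact absurd h.1 hje
    · exact h.1
  have hadj' : ∀ u : {p // p ∉ T ∧ p ≠ e}, ∀ q, ¬ (starNetwork e T).Adj u q := by
    rintro u q ⟨-, h | h⟩
    · exact u.2.2 h.1
    · exact u.2.1 h.2
  obtain ⟨W, κ, _, _, lab, A, hκ, hA, hAu, hfin, hne⟩ :=
    P.exists_branch hadj _ (erasedState_ne_zero hQ0 e hf0)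
  obtain ⟨w₀⟩ : Nonempty W := by
    by_contra hW
    rw [not_nonempty_iff] at hW
    exact hne (by ext; simp [contract])
  have hcor : ∀ φ ∈ C, ∃ ε : Fin Q → ℂ, ∀ x y z,
      contract A (erasedState e φ) x y z = φ x * ε z := fun φ hφ => hP φ hφ _ (hfin _)
  obtain ⟨ε, hε⟩ := hcor _ (hfC i₀)
  -- The branch is linear, so compare its action on `f i₀`, `f i` and their sum; pairing with `f i₀`
  -- and `f i` identifies all three residual states.
  have hεi : ∀ i x y z, contract A (erasedState e (f i)) x y z = f i x * ε z := by
    intro i x y z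
    by_cases hi : i = i₀
    · subst hi; exact hε x y z
    obtain ⟨ε₁, hε₁⟩ := hcor _ (hfC i)
    obtain ⟨ε₂, hε₂⟩ := hcor _ (C.add_mem (hfC i₀) (hfC i))
    have h1 : ∀ x, f i₀ x * ε z + f i x * ε₁ z = (f i₀ x + f i x) * ε₂ z := by
      intro x
      have h2 := hε₂ x y z
      rw [contract_erasedState_add, Pi.add_apply, Pi.add_apply, Pi.add_apply, hε, hε₁] at h2
      simpa using h2
    have h3 : ∀ k, ∑ x, conj (f k x) * (f i₀ x * ε z + f i x * ε₁ z) =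
        ∑ x, conj (f k x) * ((f i₀ x + f i x) * ε₂ z) := fun k => by simp only [h1]
    simp only [mul_add, add_mul, ← mul_assoc, Finset.sum_add_distrib, ← Finset.sum_mul,
      horth] at h3
    have h4 := h3 i₀
    have h5 := h3 i
    simp only [if_neg hi, if_neg (Ne.symm hi), if_true, one_mul, zero_mul, add_zero, zero_add]
      at h4 h5
    rw [hε₁, h5, h4]
  have hε0 : ε ≠ 0 := by
    rintro rfl
    apply hne
    ext x y z
    rw [hε]
    simp
  have hcard : ((Fintype.card (Fin (Q ^ (2 * t - n))) : ℕ) : ℂ) ≠ 0 := by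
    exact_mod_cast Fintype.card_ne_zero
  have hcQ : ((Fintype.card (Fin Q) : ℕ) : ℂ) ≠ 0 := by exact_mod_cast Fintype.card_ne_zero
  have := card_sq_le_of_recovery
    (fun i a z s u => f i ((splitEquiv₄ (Fin Q) hj he).symm (a, z, s, u))) _ _ _
    (inv_ne_zero (mul_ne_zero hcQ (by exact_mod_cast Fintype.card_ne_zero)))
    (mul_ne_zero (inv_ne_zero (mul_ne_zero hcQ hcQ)) hcard)
    ((hmix T hT).sum_splitEquiv₄ hj he) ((hiso _ hcardP).sum_splitEquiv₄ hj he)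
    (hpair.sum_pair_splitEquiv₄ hj he) lab (fun w a' a => A w j a' a noMessage)
    (fun w w' h => by simp only [hA w w' h])
    (fun w z' s' s => A w e z' ⟨0, hQ0⟩ noMessage *
      ∏ p : {p // p ∈ T ∧ p ≠ j}, A w p (s' p) (s p) noMessage)
    -- The nodes outside `T` have no channels, so their tensors are independent of `w` and may be
    -- evaluated at the fixed label `w₀`.
    (fun u' u => ∏ p : {p // p ∉ T ∧ p ≠ e}, A w₀ p (u' p) (u p) noMessage) ε hε0
    (by
      intro i a' z' s' u' z
      rw [← hεi i _ (fun _ _ => 0) z, contract_erasedState_splitEquiv₄ hQ0]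
      refine Finset.sum_congr rfl fun w _ => ?_
      have : ∀ p : {p // p ∉ T ∧ p ≠ e}, A w₀ p = A w p := fun p => hAu p (hadj' p) _ _
      simp only [this])
  rw [Fintype.card_fin] at this
  exact this.trans hκ

open Classical in
theorem edgeFinset_starNetwork {e : Fin n} {T : Finset (Fin n)} (he : e ∉ T) :
    (starNetwork e T).edgeFinset = T.image fun j => s(j, e) := by
  ext h
  induction h using Sym2.ind with
  | _ p q =>
    rw [SimpleGraph.mem_edgeFinset, SimpleGraph.mem_edgeSet, Finset.mem_image]
    simp only [starNetwork, Sym2.eq_iff]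
    constructor
    · rintro ⟨-, ⟨rfl, h⟩ | ⟨rfl, h⟩⟩
      · exact ⟨q, h, Or.inr ⟨rfl, rfl⟩⟩
      · exact ⟨p, h, Or.inl ⟨rfl, rfl⟩⟩
    · rintro ⟨j, hj, ⟨rfl, rfl⟩ | ⟨rfl, rfl⟩⟩
      · exact ⟨ne_of_mem_of_not_mem hj he, Or.inr ⟨rfl, hj⟩⟩
      · exact ⟨(ne_of_mem_of_not_mem hj he).symm, Or.inl ⟨rfl, hj⟩⟩

theorem cost_starNetwork {e : Fin n} {T : Finset (Fin n)} (he : e ∉ T)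
    (P : StorageProtocol Q (starNetwork e T)) :
    P.cost = ∑ j ∈ T, Real.logb Q (P.channelDim s(j, e)) := by
  classical
  unfold Protocol.cost
  rw [edgeFinset_starNetwork he, Finset.sum_image]
  intro p hp q hq h
  rcases Sym2.eq_iff.1 h with h | h
  · exact h.1
  · exact absurd (h.1 ▸ hp) he

theorem two_mul_le_cost {t : ℕ} (hQ : 2 ≤ Q) (ht : 1 < t) (htn : t < n) (hn : n ≤ 2 * t)
    {C : Submodule ℂ (Qudits Q n)} (hC : IsQuantumMDS (2 * t - n) C) {e : Fin n}
    {T : Finset (Fin n)} (he : e ∉ T) (hT : T.card = t)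
    (P : StorageProtocol Q (starNetwork e T)) (hP : Corrects C e P) : 2 * (t : ℝ) ≤ P.cost := by
  have hQ1 : (1 : ℝ) < Q := by exact_mod_cast (by omega : 1 < Q)
  rw [cost_starNetwork he]
  calc 2 * (t : ℝ) = ∑ j ∈ T, (2 : ℝ) := by rw [Finset.sum_const, hT, nsmul_eq_mul, mul_comm]
    _ ≤ _ := by
      refine Finset.sum_le_sum fun j hj => ?_
      have h := sq_le_channelDim hQ ht htn hn hC he hT hj P hP
      have h2 : ((Q : ℝ)) ^ (2 : ℝ) ≤ P.channelDim s(j, e) := by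
        rw [Real.rpow_two]; exact_mod_cast h
      rw [Real.le_logb_iff_rpow_le hQ1 (lt_of_lt_of_le (by positivity) h2)]
      exact h2

end CutBound

/-! ### The recovery operator of the hub. -/

section HubKernel

variable {ι α I : Type*} [DecidableEq ι] [Fintype ι] [Fintype α] [Fintype I]

/-- Converts restricted sums into the redundant sums used by `Isometric` and `MaxMixed`. -/
theorem card_mul_sum_agree [DecidableEq α] (S : Finset ι) (w : ι → α) (h : (ι → α) → ℂ) :
    (Fintype.card (S → α) : ℂ) * ∑ r, (if ∀ p ∈ S, r p = w p then h r else 0) =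
      ∑ y, h (S.piecewise w y) := by
  have hres : ∀ r, (∀ p ∈ S, (splitEquiv α S).symm r p = w p) ↔ r.1 = fun p : S => w p := by
    intro r
    have h : (fun p : S => (splitEquiv α S).symm r p) = r.1 :=
      congrArg Prod.fst ((splitEquiv α S).apply_symm_apply r)
    simp only [← h, funext_iff, Subtype.forall]
  rw [← (splitEquiv α S).symm.sum_comp, ← (splitEquiv α S).symm.sum_comp]
  simp only [hres, piecewise_splitEquiv_symm_right, Fintype.sum_prod_type]
  rw [Finset.sum_const, Finset.card_univ, nsmul_eq_mul, Finset.sum_comm]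
  simp

theorem sum_sum_update (e : ι) (h : (ι → α) → ℂ) :
    ∑ v, ∑ w, h (Function.update w e v) = Fintype.card α * ∑ w, h w := by
  let E : α × (ι → α) ≃ α × (ι → α) :=
    { toFun := fun p => (p.2 e, Function.update p.2 e p.1)
      invFun := fun p => (p.2 e, Function.update p.2 e p.1)
      left_inv := fun p => by simp
      right_inv := fun p => by simp }
  calc _ = ∑ p : α × (ι → α), h (Function.update p.2 e p.1) := by rw [Fintype.sum_prod_type]
    _ = ∑ p : α × (ι → α), h p.2 := Fintype.sum_equiv E _ _ fun p => rfl
    _ = _ := by rw [Fintype.sum_prod_type]; simp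

/-- The number of configurations with prescribed values off `S`. -/
noncomputable def fiberCard (α : Type*) [Fintype α] (S : Finset ι) : ℂ :=
  (Fintype.card ((Sᶜ : Finset ι) → α) : ℂ)⁻¹ * Fintype.card (ι → α)

theorem sum_agree_const [DecidableEq α] [Nonempty α] (S : Finset ι) (w : ι → α) (c : ℂ) :
    ∑ r : ι → α, (if ∀ p, p ∉ S → r p = w p then c else 0) = fiberCard α S * c := by
  have h := card_mul_sum_agree Sᶜ w fun _ => c
  have h0 : (Fintype.card ((Sᶜ : Finset ι) → α) : ℂ) ≠ 0 := by
    exact_mod_cast Fintype.card_ne_zero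
  rw [fiberCard, mul_assoc, ← inv_mul_cancel_left₀ h0 (∑ r, _)]
  congr 1
  simp only [← Finset.mem_compl]
  rw [h]
  simp

/-- The operator of the hub that measures the erased qudit with outcome `v` and restores the code
state: it maps configurations of `T` to configurations of `T ∪ {e}`. -/
noncomputable def hubKernel (f : I → (ι → α) → ℂ) (T : Finset ι) (e : ι) (v : α)
    (r' r : ι → α) : ℂ :=
  ∑ i, ∑ w, f i ((insert e T).piecewise r' w) * conj (f i (T.piecewise r (Function.update w e v)))

theorem hubKernel_congr_right (f : I → (ι → α) → ℂ) (T : Finset ι) (e : ι) (v : α)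
    (r' : ι → α) {r s : ι → α} (h : ∀ p ∈ T, r p = s p) :
    hubKernel f T e v r' r = hubKernel f T e v r' s := by
  have : ∀ y, T.piecewise r y = T.piecewise s y := by
    intro y; ext p
    by_cases hp : p ∈ T <;> simp [Finset.piecewise, hp]
    exact h p hp
  simp only [hubKernel, this]

theorem hubKernel_congr_left (f : I → (ι → α) → ℂ) (T : Finset ι) (e : ι) (v : α)
    (r : ι → α) {r' s' : ι → α} (h : ∀ p ∈ insert e T, r' p = s' p) :
    hubKernel f T e v r' r = hubKernel f T e v s' r := by
  have : ∀ y, (insert e T).piecewise r' y = (insert e T).piecewise s' y := by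
    intro y; ext p
    by_cases hp : p ∈ insert e T
    · rw [Finset.piecewise_eq_of_mem _ _ _ hp, Finset.piecewise_eq_of_mem _ _ _ hp, h p hp]
    · rw [Finset.piecewise_eq_of_notMem _ _ _ hp, Finset.piecewise_eq_of_notMem _ _ _ hp]
  simp only [hubKernel, this]

/-- Isometry on `T ∪ {e}` makes the output sum diagonal in the index and in the outside values.
Summing over `v` then fills in the coordinate at `e`, which leaves the reduced state on `T`, and
this is maximally mixed. -/
theorem sum_conj_hubKernel_mul [DecidableEq α] [Nonempty α] [DecidableEq I] {f : I → (ι → α) → ℂ} {T : Finset ι}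
    (e : ι) (hiso : Isometric f T) (hmix : MaxMixed f T) (r r₂ : ι → α) :
    ∑ v, ∑ r', conj (hubKernel f T e v r' r) * hubKernel f T e v r' r₂ =
      if ∀ p ∈ T, r p = r₂ p then
        fiberCard α (insert e T) * (Fintype.card α * Fintype.card I) else 0 := by
  have hS := hiso.mono (Finset.subset_insert e T)
  have hS' : ∀ i j y y', ∑ x, conj (f i ((insert e T).piecewise x y)) *
      f j ((insert e T).piecewise x y') =
        if i = j ∧ ∀ p, p ∉ insert e T → y' p = y p then 1 else 0 := by
    intro i j y y'
    split_ifs with h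
    · obtain ⟨rfl, h⟩ := h
      exact hS.1 i y y' fun p hp => (h p hp).symm
    · exact hS.2 i j y y' fun h' => h ⟨h'.1, fun p hp => (h'.2 p hp).symm⟩
  have key : ∀ v, ∑ r', conj (hubKernel f T e v r' r) * hubKernel f T e v r' r₂ =
      fiberCard α (insert e T) * ∑ i, ∑ w, f i (T.piecewise r (Function.update w e v)) *
        conj (f i (T.piecewise r₂ (Function.update w e v))) := by
    intro v
    calc _ = ∑ i, ∑ w, ∑ j, ∑ w₂, f i (T.piecewise r (Function.update w e v)) *
          conj (f j (T.piecewise r₂ (Function.update w₂ e v))) *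
          ∑ r', conj (f i ((insert e T).piecewise r' w)) * f j ((insert e T).piecewise r' w₂) := by
          simp only [hubKernel, map_sum, map_mul, Complex.conj_conj, Finset.sum_mul,
            Finset.mul_sum]
          have comm : ∀ g : (ι → α) → (I × (ι → α)) × (I × (ι → α)) → ℂ,
            ∑ x, ∑ y, g x y = ∑ y, ∑ x, g x y := fun g => Finset.sum_comm
          have h := comm fun r' q => conj (f q.1.1 ((insert e T).piecewise r' q.1.2)) *
            f q.1.1 (T.piecewise r (Function.update q.1.2 e v)) *
            (f q.2.1 ((insert e T).piecewise r' q.2.2) *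
              conj (f q.2.1 (T.piecewise r₂ (Function.update q.2.2 e v))))
          simp only [Fintype.sum_prod_type] at h
          refine Eq.trans ?_ (h.trans ?_)
          · refine Finset.sum_congr rfl fun r' _ => ?_
            have comm2 : ∀ g : (I × (ι → α)) → (I × (ι → α)) → ℂ,
              ∑ x, ∑ y, g x y = ∑ y, ∑ x, g x y := fun g => Finset.sum_comm
            have h2 := comm2 fun a b => conj (f b.1 ((insert e T).piecewise r' b.2)) *
              f b.1 (T.piecewise r (Function.update b.2 e v)) *
              (f a.1 ((insert e T).piecewise r' a.2) *
                conj (f a.1 (T.piecewise r₂ (Function.update a.2 e v))))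
            simp only [Fintype.sum_prod_type] at h2
            exact h2
          · exact Finset.sum_congr rfl fun _ _ => Finset.sum_congr rfl fun _ _ =>
              Finset.sum_congr rfl fun _ _ => Finset.sum_congr rfl fun _ _ =>
              Finset.sum_congr rfl fun _ _ => by ring
      _ = ∑ i, ∑ w : ι → α, ∑ w₂ : ι → α, (if ∀ p, p ∉ insert e T → w₂ p = w p then
          f i (T.piecewise r (Function.update w e v)) *
          conj (f i (T.piecewise r₂ (Function.update w e v))) else 0) := by
          simp only [hS', ite_and, mul_ite, mul_one, mul_zero]
          refine Finset.sum_congr rfl fun i _ => Finset.sum_congr rfl fun w _ => ?_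
          rw [Finset.sum_comm]
          refine Finset.sum_congr rfl fun w₂ _ => ?_
          rw [Finset.sum_ite_eq, if_pos (Finset.mem_univ _)]
          refine if_ctx_congr Iff.rfl (fun h => ?_) fun _ => rfl
          have : T.piecewise r₂ (Function.update w₂ e v) =
              T.piecewise r₂ (Function.update w e v) := by
            ext p
            by_cases hp : p ∈ T
            · simp [Finset.piecewise, hp]
            · by_cases hpe : p = e
              · subst hpe; simp [Finset.piecewise, hp]
              · simp [Finset.piecewise, hp, hpe, h p (by simp [hp, hpe])]
          rw [this]
      _ = _ := by
          simp only [sum_agree_const, Finset.mul_sum]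
  simp only [key, ← Finset.mul_sum]
  rw [Finset.sum_comm]
  have h2 : ∀ i, ∑ v, ∑ w, f i (T.piecewise r (Function.update w e v)) *
        conj (f i (T.piecewise r₂ (Function.update w e v))) =
      Fintype.card α * ∑ w, f i (T.piecewise r w) * conj (f i (T.piecewise r₂ w)) := fun i =>
    sum_sum_update e fun w => f i (T.piecewise r w) * conj (f i (T.piecewise r₂ w))
  simp only [h2, ← Finset.mul_sum]
  change _ * (_ * reduced f T r r₂) = _
  split_ifs with h
  · rw [hmix.1 _ _ h]
  · rw [hmix.2 _ _ h, mul_zero, mul_zero]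

/-- Isometry on `T` makes the overlap vanish unless the index and the outside values match and the
erased qudit has value `v`. The code vector is rebuilt and the erased qudit ends in a basis state
independent of it. The value `a₀` is the hub's own memory, which the kernel ignores. -/
theorem sum_hubKernel_mul [DecidableEq α] [Nonempty α] [DecidableEq I] {f : I → (ι → α) → ℂ} {T : Finset ι}
    {e : ι} (he : e ∉ T) (hiso : Isometric f T) (j : I) (a₀ v z : α) (x : ι → α) :
    ∑ r : ι → α, (if (∀ p, p ∉ insert e T → r p = x p) ∧ r e = a₀ then
        hubKernel f T e v x r * f j (Function.update r e z) else 0) =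
      f j x * if z = v then (Fintype.card ((Tᶜ : Finset ι) → α) : ℂ)⁻¹ *
        fiberCard α (insert e T) else 0 := by
  have h0 : (Fintype.card ((Tᶜ : Finset ι) → α) : ℂ) ≠ 0 := by
    exact_mod_cast Fintype.card_ne_zero
  have hiff : ∀ r : ι → α, ((∀ p, p ∉ insert e T → r p = x p) ∧ r e = a₀) ↔
      ∀ p ∈ Tᶜ, r p = Function.update x e a₀ p := by
    intro r
    constructor
    · rintro ⟨h1, h2⟩ p hp
      by_cases hpe : p = e
      · subst hpe; simpa using h2
      · simpa [hpe] using h1 p (by simpa [hpe] using hp)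
    · intro h
      refine ⟨fun p hp => ?_, by simpa using h e (by simpa using he)⟩
      simp only [Finset.mem_insert, not_or] at hp
      simpa [hp.1] using h p (by simpa using hp.2)
  simp only [hiff]
  rw [← inv_mul_cancel_left₀ h0 (∑ r, _), card_mul_sum_agree]
  have h1 : ∀ s, hubKernel f T e v x (Tᶜ.piecewise (Function.update x e a₀) s) =
      hubKernel f T e v x s := fun s =>
    hubKernel_congr_right f T e v x fun p hp => by simp [Finset.piecewise, hp]
  have h2 : ∀ s, Function.update (Tᶜ.piecewise (Function.update x e a₀) s) e z =
      T.piecewise s (Function.update x e z) := by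
    intro s; ext p
    by_cases hpe : p = e
    · subst hpe; simp [Finset.piecewise, he]
    · by_cases hp : p ∈ T <;> simp [Finset.piecewise, hp, hpe]
  simp only [h1, h2]
  have hiso' : ∀ i y y', ∑ s, conj (f i (T.piecewise s y)) * f j (T.piecewise s y') =
        if i = j ∧ ∀ p, p ∉ T → y p = y' p then 1 else 0 := by
    intro i y y'
    split_ifs with h
    · obtain ⟨rfl, h⟩ := h
      exact hiso.1 i y y' h
    · exact hiso.2 i j y y' h
  have h3 : ∀ w, (∀ p, p ∉ T → Function.update w e v p = Function.update x e z p) ↔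
      z = v ∧ ∀ p, p ∉ insert e T → w p = x p := by
    intro w
    constructor
    · intro h
      refine ⟨by simpa using (h e he).symm, fun p hp => ?_⟩
      simp only [Finset.mem_insert, not_or] at hp
      simpa [hp.1] using h p hp.2
    · rintro ⟨rfl, h⟩ p hp
      by_cases hpe : p = e
      · subst hpe; simp
      · simpa [hpe] using h p (by simp [hp, hpe])
  have h4 : ∑ s, hubKernel f T e v x s * f j (T.piecewise s (Function.update x e z)) =
      ∑ w : ι → α, if ∀ p, p ∉ insert e T → w p = x p then (if z = v then f j x else 0) else 0 := by
    calc _ = ∑ i, ∑ w, f i ((insert e T).piecewise x w) *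
          ∑ s, conj (f i (T.piecewise s (Function.update w e v))) *
            f j (T.piecewise s (Function.update x e z)) := by
          simp only [hubKernel, Finset.sum_mul, Finset.mul_sum]
          rw [Finset.sum_comm]
          refine Finset.sum_congr rfl fun i _ => ?_
          rw [Finset.sum_comm]
          simp only [mul_assoc]
      _ = _ := by
          simp only [hiso', h3, ite_and, mul_ite, mul_one, mul_zero]
          rw [Finset.sum_comm]
          refine Finset.sum_congr rfl fun w _ => ?_
          rw [Finset.sum_ite_eq', if_pos (Finset.mem_univ _)]
          by_cases hz : z = v
          · simp only [hz, if_true]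
            refine if_ctx_congr Iff.rfl (fun h => ?_) fun _ => rfl
            congr 1
            ext p
            by_cases hp : p ∈ insert e T
            · rw [Finset.piecewise_eq_of_mem _ _ _ hp]
            · rw [Finset.piecewise_eq_of_notMem _ _ _ hp, h p hp]
          · simp [hz]
  rw [h4, sum_agree_const]
  split_ifs
  · ring
  · simp

end HubKernel

/-! ### Moving a qudit between memory and messages. -/

section Registers

variable {n : ℕ}

/-- The value stored in a memory and messages of which only one is nontrivial. -/
def regVal {M : ℕ} {ν : Fin n → ℕ} (b : Fin M × ∀ q, Fin (ν q)) : ℕ :=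
  (b.1 : ℕ) + ∑ q, (b.2 q : ℕ)

/-- A memory of dimension `M` and messages of dimensions `ν` together store one `N`-dimensional
system. -/
structure IsRegister (M : ℕ) (ν : Fin n → ℕ) (N : ℕ) : Prop where
  injective : Function.Injective (regVal : Fin M × (∀ q, Fin (ν q)) → ℕ)
  lt : ∀ b : Fin M × ∀ q, Fin (ν q), regVal b < N
  exists_eq : ∀ k < N, ∃ b : Fin M × ∀ q, Fin (ν q), regVal b = k

theorem val_eq_zero_of_eq_one {N : ℕ} (hN : N = 1) (k : Fin N) : (k : ℕ) = 0 := by omega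

theorem regVal_eq_memory {M : ℕ} {ν : Fin n → ℕ} (hν : ∀ q, ν q = 1)
    (b : Fin M × ∀ q, Fin (ν q)) : regVal b = b.1 := by
  simp [regVal, fun q => val_eq_zero_of_eq_one (hν q) (b.2 q)]

theorem regVal_eq_message {M : ℕ} {ν : Fin n → ℕ} (hM : M = 1) {q₀ : Fin n}
    (hν : ∀ q, q ≠ q₀ → ν q = 1) (b : Fin M × ∀ q, Fin (ν q)) : regVal b = b.2 q₀ := by
  rw [regVal, val_eq_zero_of_eq_one hM, zero_add]
  exact Finset.sum_eq_single q₀ (fun q _ hq => val_eq_zero_of_eq_one (hν q hq) _) (by simp)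

theorem isRegister_memory {M : ℕ} {ν : Fin n → ℕ} (hν : ∀ q, ν q = 1) : IsRegister M ν M where
  injective b b' h := by
    rw [regVal_eq_memory hν, regVal_eq_memory hν] at h
    refine Prod.ext (Fin.ext h) (funext fun q => Fin.ext ?_)
    rw [val_eq_zero_of_eq_one (hν q), val_eq_zero_of_eq_one (hν q)]
  lt b := by rw [regVal_eq_memory hν]; exact b.1.2
  exists_eq k hk := ⟨(⟨k, hk⟩, fun q => ⟨0, by rw [hν]; exact one_pos⟩), by rw [regVal_eq_memory hν]⟩

theorem isRegister_message {M N : ℕ} {ν : Fin n → ℕ} (hM : M = 1) {q₀ : Fin n} (h₀ : ν q₀ = N)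
    (hν : ∀ q, q ≠ q₀ → ν q = 1) : IsRegister M ν N where
  injective b b' h := by
    rw [regVal_eq_message hM hν, regVal_eq_message hM hν] at h
    refine Prod.ext (Fin.ext ?_) (funext fun q => Fin.ext ?_)
    · rw [val_eq_zero_of_eq_one hM, val_eq_zero_of_eq_one hM]
    · by_cases hq : q = q₀
      · subst hq; exact h
      · rw [val_eq_zero_of_eq_one (hν q hq), val_eq_zero_of_eq_one (hν q hq)]
  lt b := by rw [regVal_eq_message hM hν, ← h₀]; exact (b.2 q₀).2
  exists_eq k hk := by
    have hpos : ∀ q, 0 < ν q := by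
      intro q
      by_cases hq : q = q₀
      · rw [hq, h₀]; omega
      · rw [hν q hq]; exact one_pos
    refine ⟨(⟨0, by omega⟩, fun q => if h : q = q₀ then ⟨k, by rw [h, h₀]; exact hk⟩ else
      ⟨0, hpos q⟩), ?_⟩
    rw [regVal_eq_message hM hν]
    simp

variable {m : Fin n → ℕ} {μ : Fin n → Fin n → ℕ} {m' : Fin n → ℕ} {μ' : Fin n → Fin n → ℕ}

/-- The operator that moves basis states between registers. -/
def moveOp {p : Fin n} : LocalOp m μ m' μ' p :=
  Matrix.of fun a b =>
    if (a.1 : ℕ) + ∑ q, (a.2 q : ℕ) = (b.1 : ℕ) + ∑ q, (b.2 q : ℕ) then 1 else 0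

theorem moveOp_apply {p : Fin n} (a) (b) : (moveOp : LocalOp m μ m' μ' p) a b =
    if regVal a = regVal b then 1 else 0 := rfl

/-- Both sides enumerate the values `0, …, N - 1` exactly once, so the operator is a relabelling of
basis states. -/
theorem moveOp_complete {p : Fin n} {N : ℕ} (hin : IsRegister (m p) (fun q => μ q p) N)
    (hout : IsRegister (m' p) (μ' p) N) :
    (moveOp : LocalOp m μ m' μ' p).conjTranspose * (moveOp : LocalOp m μ m' μ' p) = 1 := by
  ext b b'
  obtain ⟨a, ha⟩ := hout.exists_eq _ (hin.lt b)
  simp only [Matrix.mul_apply, Matrix.conjTranspose_apply, moveOp_apply]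
  rw [Finset.sum_eq_single a]
  · simp only [ha, if_true, star_one, one_mul, Matrix.one_apply]
    exact if_congr hin.injective.eq_iff rfl rfl
  · intro a' _ ha'
    rw [if_neg, star_zero, zero_mul]
    exact fun h => ha' (hout.injective (h.trans ha.symm))
  · simp

variable {Q : ℕ} [NeZero Q]

theorem sum_config (h : ∀ p, IsRegister (m p) (μ p) Q) (F : (Fin n → Fin Q) → ℂ) :
    ∑ x : ∀ p, Fin (m p), ∑ y : ∀ p q, Fin (μ p q),
      F (fun p => Fin.ofNat Q (regVal (x p, y p))) = ∑ r, F r := by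
  have hval : ∀ p (b : Fin (m p) × ∀ q, Fin (μ p q)), (Fin.ofNat Q (regVal b) : ℕ) = regVal b :=
    fun p b => Nat.mod_eq_of_lt ((h p).lt b)
  have hbij : Function.Bijective fun r : (∀ p, Fin (m p)) × (∀ p q, Fin (μ p q)) =>
      fun p => Fin.ofNat Q (regVal (r.1 p, r.2 p)) := by
    constructor
    · rintro ⟨x, y⟩ ⟨x', y'⟩ hxy
      have h1 : ∀ p, (x p, y p) = (x' p, y' p) := fun p => (h p).injective
        ((hval p _).symm.trans ((congrArg Fin.val (congrFun hxy p)).trans (hval p _)))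
      exact Prod.ext (funext fun p => congrArg Prod.fst (h1 p))
        (funext fun p => congrArg Prod.snd (h1 p))
    · intro r
      choose b hb using fun p => (h p).exists_eq (r p) (r p).2
      exact ⟨(fun p => (b p).1, fun p => (b p).2), funext fun p => Fin.ext (by
        rw [hval]; exact hb p)⟩
  rw [← hbij.sum_comp F, Fintype.sum_prod_type]

/-- Here messages are grouped by receiver instead of sender; transposing the message indices relates
the two. -/
theorem sum_config' (h : ∀ p, IsRegister (m p) (fun q => μ q p) Q) (F : (Fin n → Fin Q) → ℂ) :
    ∑ x : ∀ p, Fin (m p), ∑ y : ∀ p q, Fin (μ p q),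
      F (fun p => Fin.ofNat Q (regVal (x p, fun q => y q p))) = ∑ r, F r := by
  rw [← sum_config h F]
  refine Finset.sum_congr rfl fun x _ => ?_
  exact Fintype.sum_equiv (Equiv.piComm fun p q => Fin (μ p q)) _ _ fun y => rfl

/-- Written as a function `g` of the stored values, the state is unaffected by a round of moves,
whichever registers hold the values. -/
theorem applyLocal_moveOp (hin : ∀ p, IsRegister (m p) (fun q => μ q p) Q)
    (hout : ∀ p, IsRegister (m' p) (μ' p) Q) {ψ : State Q m μ}
    {g : (Fin n → Fin Q) → Fin Q → ℂ}
    (hψ : ∀ x y z, ψ x y z = g (fun p => Fin.ofNat Q (regVal (x p, fun q => y q p))) z) (x' y' z) :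
    applyLocal (fun p => (moveOp : LocalOp m μ m' μ' p)) ψ x' y' z =
      g (fun p => Fin.ofNat Q (regVal (x' p, y' p))) z := by
  have h : ∀ (x : ∀ p, Fin (m p)) (y : ∀ p q, Fin (μ p q)),
      (∏ p, (moveOp : LocalOp m μ m' μ' p) (x' p, fun q => y' p q) (x p, fun q => y q p)) *
        ψ x y z =
      (fun r => if (fun p => Fin.ofNat Q (regVal (x' p, y' p))) = r then g r z else 0)
        (fun p => Fin.ofNat Q (regVal (x p, fun q => y q p))) := by
    intro x y
    simp only [moveOp_apply, hψ, Finset.prod_ite_zero, Finset.prod_const_one, ite_mul, one_mul,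
      zero_mul]
    refine if_congr ?_ rfl rfl
    simp only [funext_iff, Fin.ext_iff, Finset.mem_univ, true_imp_iff]
    refine forall_congr' fun p => ?_
    change _ ↔ _ % Q = _ % Q
    rw [Nat.mod_eq_of_lt ((hout p).lt _), Nat.mod_eq_of_lt ((hin p).lt _)]
  simp only [applyLocal, h]
  exact (sum_config' hin fun r => if (fun p => Fin.ofNat Q (regVal (x' p, y' p))) = r
    then g r z else 0).trans (by simp)

end Registers

/-! ### Kraus operators of the hub. -/

section Hub

variable {n Q : ℕ} [NeZero Q]

/-- The values stored in the memory of the hub `e` and in the messages of the helpers. -/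
def hubConfig (e : Fin n) {M : ℕ} {ν : Fin n → ℕ} (a : Fin M × ∀ q, Fin (ν q)) : Fin n → Fin Q :=
  fun p => Fin.ofNat Q (if p = e then (a.1 : ℕ) else a.2 p)

section

variable {M : ℕ} {ν : Fin n → ℕ} {e : Fin n} {T : Finset (Fin n)}

theorem val_hubConfig_of_ne (h₁ : ∀ q ∈ T, ν q = Q) (h₂ : ∀ q, q ∉ T → ν q = 1)
    (a : Fin M × ∀ q, Fin (ν q)) {p : Fin n} (hp : p ≠ e) :
    (hubConfig (Q := Q) e a p : ℕ) = a.2 p := by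
  simp only [hubConfig, if_neg hp]
  refine Nat.mod_eq_of_lt (lt_of_lt_of_le (a.2 p).2 ?_)
  by_cases hpT : p ∈ T
  · rw [h₁ p hpT]
  · rw [h₂ p hpT]; exact NeZero.one_le

theorem val_hubConfig_self (hM : M = Q) (a : Fin M × ∀ q, Fin (ν q)) :
    (hubConfig (Q := Q) e a e : ℕ) = a.1 := by
  simp only [hubConfig, if_true]
  exact Nat.mod_eq_of_lt (lt_of_lt_of_eq a.1.2 hM)

theorem hubConfig_eq_zero (h₁ : ∀ q ∈ T, ν q = Q) (h₂ : ∀ q, q ∉ T → ν q = 1)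
    (a : Fin M × ∀ q, Fin (ν q)) {p : Fin n} (hp : p ∉ insert e T) :
    hubConfig (Q := Q) e a p = 0 := by
  simp only [Finset.mem_insert, not_or] at hp
  apply Fin.ext
  rw [val_hubConfig_of_ne h₁ h₂ a hp.1, val_eq_zero_of_eq_one (h₂ p hp.2)]
  rfl

theorem eq_of_hubConfig (he : e ∉ T) (h₁ : ∀ q ∈ T, ν q = Q)
    (h₂ : ∀ q, q ∉ T → ν q = 1) {a a' : Fin M × ∀ q, Fin (ν q)} (h0 : a.1 = a'.1)
    (h : ∀ p ∈ T, hubConfig (Q := Q) e a p = hubConfig e a' p) : a = a' := by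
  refine Prod.ext h0 (funext fun p => Fin.ext ?_)
  by_cases hp : p ∈ T
  · have hpe : p ≠ e := ne_of_mem_of_not_mem hp he
    rw [← val_hubConfig_of_ne h₁ h₂ a hpe, ← val_hubConfig_of_ne h₁ h₂ a' hpe, h p hp]
  · rw [val_eq_zero_of_eq_one (h₂ p hp), val_eq_zero_of_eq_one (h₂ p hp)]

theorem sum_hubConfig (hM : M = Q) (he : e ∉ T) (h₁ : ∀ q ∈ T, ν q = Q)
    (h₂ : ∀ q, q ∉ T → ν q = 1) (F : (Fin n → Fin Q) → ℂ) :
    ∑ a : Fin M × (∀ q, Fin (ν q)), F (hubConfig e a) =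
      ∑ r : Fin n → Fin Q, if ∀ p ∈ (insert e T)ᶜ, r p = 0 then F r else 0 := by
  rw [← Finset.sum_filter]
  refine Finset.sum_bij (fun a _ => hubConfig e a) ?_ ?_ ?_ fun _ _ => rfl
  · intro a _
    rw [Finset.mem_filter]
    exact ⟨Finset.mem_univ _, fun p hp => hubConfig_eq_zero h₁ h₂ a (Finset.mem_compl.1 hp)⟩
  · intro a _ a' _ h
    refine eq_of_hubConfig he h₁ h₂ (Fin.ext ?_) fun p _ => congrFun h p
    rw [← val_hubConfig_self (Q := Q) (e := e) hM, ← val_hubConfig_self (Q := Q) (e := e) hM, h]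
  · intro r hr
    rw [Finset.mem_filter] at hr
    refine ⟨(⟨r e, by rw [hM]; exact (r e).2⟩, fun q => ⟨if q ∈ T then r q else 0, ?_⟩),
      Finset.mem_univ _, funext fun p => Fin.ext ?_⟩
    · by_cases hq : q ∈ T
      · rw [if_pos hq, h₁ q hq]; exact (r q).2
      · rw [if_neg hq, h₂ q hq]; exact one_pos
    · by_cases hpe : p = e
      · subst hpe
        rw [val_hubConfig_self hM]
      · rw [val_hubConfig_of_ne h₁ h₂ _ hpe]
        by_cases hp : p ∈ T
        · simp [hp]
        · rw [hr.2 p (by simp [hp, hpe])]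
          simp [hp]

end

variable {m : Fin n → ℕ} {μ : Fin n → Fin n → ℕ} {m' : Fin n → ℕ} {μ' : Fin n → Fin n → ℕ}
  {I : Type*} [Fintype I]

/-- The Kraus operators of the hub: the outcome `k` encodes the outcome `k / Q` of the measurement
of the erased qudit, and the outcome `k % Q` of a measurement of the memory of the hub. -/
noncomputable def hubOp (f : I → (Fin n → Fin Q) → ℂ) (T : Finset (Fin n)) (e : Fin n) (α : ℂ)
    (k : ℕ) {p : Fin n} : LocalOp m μ m' μ' p :=
  Matrix.of fun a c => if (c.1 : ℕ) = k % Q then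
    α * hubKernel f T e (Fin.ofNat Q (k / Q)) (hubConfig e a) (hubConfig e c) else 0

theorem sum_fin_mul {N : ℕ} (hN : N = Q * Q) (F : ℕ → ℕ → ℂ) :
    ∑ k : Fin N, F ((k : ℕ) / Q) ((k : ℕ) % Q) = ∑ v : Fin Q, ∑ b : Fin Q, F v b := by
  subst hN
  rw [← finProdFinEquiv.sum_comp, Fintype.sum_prod_type]
  refine Finset.sum_congr rfl fun v _ => Finset.sum_congr rfl fun b _ => ?_
  have hQ : 0 < Q := NeZero.pos Q
  simp only [finProdFinEquiv_apply_val]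
  rw [Nat.add_mul_div_left _ _ hQ, Nat.div_eq_of_lt b.2, zero_add, Nat.add_mul_mod_self_left,
    Nat.mod_eq_of_lt b.2]

/-- The kernel ignores the hub's memory, so the kernels alone cannot resolve the identity. Measuring
that memory (`k % Q`) supplies the missing diagonal condition; `sum_conj_hubKernel_mul` handles the
helpers' qudits, and `hα` normalizes. -/
theorem hubOp_complete [DecidableEq I] {f : I → (Fin n → Fin Q) → ℂ} {T : Finset (Fin n)}
    {e : Fin n} (he : e ∉ T) (hiso : Isometric f T) (hmix : MaxMixed f T) {α : ℂ}
    (hα : conj α * α * ((Fintype.card (((insert e T)ᶜ : Finset (Fin n)) → Fin Q) : ℂ)⁻¹ *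
      (fiberCard (Fin Q) (insert e T) * (Fintype.card (Fin Q) * Fintype.card I))) = 1)
    (hm : m e = Q) (h₁ : ∀ q ∈ T, μ q e = Q) (h₂ : ∀ q, q ∉ T → μ q e = 1)
    (hm' : m' e = Q) (h₁' : ∀ q ∈ T, μ' e q = Q) (h₂' : ∀ q, q ∉ T → μ' e q = 1)
    {N : ℕ} (hN : N = Q * Q) :
    ∑ k : Fin N, (hubOp f T e α k : LocalOp m μ m' μ' e).conjTranspose *
      (hubOp f T e α k : LocalOp m μ m' μ' e) = 1 := by
  ext c c'
  have hQ : 0 < Q := NeZero.pos Q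
  have hcard : (Fintype.card (((insert e T)ᶜ : Finset (Fin n)) → Fin Q) : ℂ) ≠ 0 := by
    exact_mod_cast Fintype.card_ne_zero
  have hsum : ∀ (v : Fin Q), ∑ a : Fin (m' e) × (∀ q, Fin (μ' e q)),
      conj (hubKernel f T e v (hubConfig e a) (hubConfig e c)) *
        hubKernel f T e v (hubConfig e a) (hubConfig e c') =
      (Fintype.card (((insert e T)ᶜ : Finset (Fin n)) → Fin Q) : ℂ)⁻¹ *
        ∑ r, conj (hubKernel f T e v r (hubConfig e c)) * hubKernel f T e v r (hubConfig e c') := by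
    intro v
    rw [sum_hubConfig hm' he h₁' h₂' (fun r => conj (hubKernel f T e v r (hubConfig e c)) *
      hubKernel f T e v r (hubConfig e c'))]
    rw [← inv_mul_cancel_left₀ hcard (∑ r : Fin n → Fin Q, ite _ _ _)]
    congr 1
    have h := card_mul_sum_agree (insert e T)ᶜ (fun _ => (0 : Fin Q))
      fun r => conj (hubKernel f T e v r (hubConfig e c)) * hubKernel f T e v r (hubConfig e c')
    trans ∑ y, conj (hubKernel f T e v ((insert e T)ᶜ.piecewise (fun _ => 0) y) (hubConfig e c)) *
      hubKernel f T e v ((insert e T)ᶜ.piecewise (fun _ => 0) y) (hubConfig e c')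
    · convert h
    refine Finset.sum_congr rfl fun y _ => ?_
    -- The zero padding off `T ∪ {e}` is harmless since the kernel reads only the coordinates in
    -- that set.
    have : ∀ p ∈ insert e T, (insert e T)ᶜ.piecewise (fun _ => (0 : Fin Q)) y p = y p := by
      intro p hp
      rw [Finset.piecewise_eq_of_notMem _ _ _ (fun h => Finset.mem_compl.1 h hp)]
    rw [hubKernel_congr_left f T e v _ this, hubKernel_congr_left f T e v _ this]
  have hk : ∀ v b : ℕ, ∑ a : Fin (m' e) × (∀ q, Fin (μ' e q)),
      conj (if (c.1 : ℕ) = b then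
        α * hubKernel f T e (Fin.ofNat Q v) (hubConfig e a) (hubConfig e c) else 0) *
      (if (c'.1 : ℕ) = b then
        α * hubKernel f T e (Fin.ofNat Q v) (hubConfig e a) (hubConfig e c') else 0) =
      if (c.1 : ℕ) = b then if (c'.1 : ℕ) = b then conj α * α *
        ((Fintype.card (((insert e T)ᶜ : Finset (Fin n)) → Fin Q) : ℂ)⁻¹ *
        ∑ r, conj (hubKernel f T e (Fin.ofNat Q v) r (hubConfig e c)) *
          hubKernel f T e (Fin.ofNat Q v) r (hubConfig e c')) else 0 else 0 := by
    intro v b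
    split_ifs
    · rw [← hsum, Finset.mul_sum]
      refine Finset.sum_congr rfl fun a _ => ?_
      rw [map_mul]; ring
    all_goals simp
  simp only [Matrix.sum_apply, Matrix.mul_apply, Matrix.conjTranspose_apply, hubOp, Matrix.of_apply,
    ← starRingEnd_apply]
  simp only [hk]
  rw [sum_fin_mul hN (fun v b => if (c.1 : ℕ) = b then if (c'.1 : ℕ) = b then conj α * α *
        ((Fintype.card (((insert e T)ᶜ : Finset (Fin n)) → Fin Q) : ℂ)⁻¹ *
        ∑ r, conj (hubKernel f T e (Fin.ofNat Q v) r (hubConfig e c)) *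
          hubKernel f T e (Fin.ofNat Q v) r (hubConfig e c')) else 0 else 0), Finset.sum_comm,
    Finset.sum_eq_single ⟨c.1, lt_of_lt_of_eq c.1.2 hm⟩]
  · simp only [if_true, Matrix.one_apply]
    by_cases h1 : (c'.1 : ℕ) = c.1
    · simp only [if_pos h1, ← Finset.mul_sum, Fin.ofNat_eq_cast, Fin.cast_val_eq_self,
        sum_conj_hubKernel_mul e hiso hmix]
      split_ifs with h2 h3 h3
      · exact hα
      · exact absurd (eq_of_hubConfig he h₁ h₂ (Fin.ext h1.symm) h2) h3
      · exact absurd (fun p _ => by rw [h3]) h2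
      · simp
    · rw [if_neg]
      · simp [h1]
      · rintro rfl; exact h1 rfl
  · intro b _ hb
    have : (c.1 : ℕ) ≠ b := fun h => hb (Fin.ext h.symm)
    simp [this]
  · simp

end Hub

/-! ### The download-and-return protocol, its cost and its correctness. -/

section DownloadAndReturn

variable {n Q : ℕ} (e : Fin n) (T : Finset (Fin n))

/-- The dimensions of the memories while the hub holds the qudits of the helpers. -/
def helperMemory (Q : ℕ) (p : Fin n) : ℕ := if p ∈ T then 1 else Q

/-- The dimensions of the messages in the round in which the helpers send their qudits. -/
def downloadDim (Q : ℕ) (p q : Fin n) : ℕ := if p ∈ T ∧ q = e then Q else 1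

/-- The dimensions of the messages in the round in which the hub returns the qudits. -/
def returnDim (Q : ℕ) (p q : Fin n) : ℕ := if p = e ∧ q ∈ T then Q else 1

/-- The numbers of outcomes of the round in which the hub operates. -/
def hubOutcomes (Q : ℕ) (p : Fin n) : ℕ := if p = e then Q * Q else 1

variable {e T}

theorem isRegister_initial : IsRegister Q (fun _ : Fin n => 1) Q :=
  isRegister_memory fun _ => rfl

theorem isRegister_download_sent (p : Fin n) :
    IsRegister (helperMemory T Q p) (downloadDim e T Q p) Q := by
  by_cases hp : p ∈ T
  · exact isRegister_message (q₀ := e) (by simp [helperMemory, hp]) (by simp [downloadDim, hp])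
      fun q hq => by simp [downloadDim, hq]
  · have : helperMemory T Q p = Q := by simp [helperMemory, hp]
    rw [this]
    exact isRegister_memory fun q => by simp [downloadDim, hp]

theorem isRegister_return_received (p : Fin n) :
    IsRegister (helperMemory T Q p) (fun q => returnDim e T Q q p) Q := by
  by_cases hp : p ∈ T
  · exact isRegister_message (q₀ := e) (by simp [helperMemory, hp]) (by simp [returnDim, hp])
      fun q hq => by simp [returnDim, hq]
  · have : helperMemory T Q p = Q := by simp [helperMemory, hp]
    rw [this]
    exact isRegister_memory fun q => by simp [returnDim, hp]

theorem isRegister_idle_received {p : Fin n} (hp : p ≠ e) :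
    IsRegister (helperMemory T Q p) (fun q => downloadDim e T Q q p) (helperMemory T Q p) :=
  isRegister_memory fun q => by simp [downloadDim, hp]

theorem isRegister_idle_sent {p : Fin n} (hp : p ≠ e) :
    IsRegister (helperMemory T Q p) (returnDim e T Q p) (helperMemory T Q p) :=
  isRegister_memory fun q => by simp [returnDim, hp]

theorem downloadDim_eq_one (he : e ∉ T) {p q : Fin n} (h : ¬ (starNetwork e T).Adj p q) :
    downloadDim e T Q p q = 1 := by
  refine if_neg ?_
  rintro ⟨hp, rfl⟩
  exact h ⟨ne_of_mem_of_not_mem hp he, Or.inr ⟨rfl, hp⟩⟩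

theorem returnDim_eq_one (he : e ∉ T) {p q : Fin n} (h : ¬ (starNetwork e T).Adj p q) :
    returnDim e T Q p q = 1 := by
  refine if_neg ?_
  rintro ⟨rfl, hq⟩
  exact h ⟨(ne_of_mem_of_not_mem hq he).symm, Or.inl ⟨rfl, hq⟩⟩

variable [NeZero Q] {I : Type*} [Fintype I]

/-- The local operators of the round in which the hub operates. -/
noncomputable def hubRound (f : I → (Fin n → Fin Q) → ℂ) (e : Fin n) (T : Finset (Fin n)) (α : ℂ)
    (p : Fin n) (k : ℕ) :
    LocalOp (helperMemory T Q) (downloadDim e T Q) (helperMemory T Q) (returnDim e T Q) p :=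
  if p = e then hubOp f T e α k else moveOp

theorem hubRound_complete [DecidableEq I] {f : I → (Fin n → Fin Q) → ℂ} (he : e ∉ T)
    (hiso : Isometric f T) (hmix : MaxMixed f T) {α : ℂ}
    (hα : conj α * α * ((Fintype.card (((insert e T)ᶜ : Finset (Fin n)) → Fin Q) : ℂ)⁻¹ *
      (fiberCard (Fin Q) (insert e T) * (Fintype.card (Fin Q) * Fintype.card I))) = 1)
    (p : Fin n) :
    ∑ k : Fin (hubOutcomes e Q p), (hubRound f e T α p k).conjTranspose * hubRound f e T α p k =
      1 := by
  by_cases hp : p = e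
  · subst hp
    simp only [hubRound, if_true]
    exact hubOp_complete he hiso hmix hα (by simp [helperMemory, he])
      (fun q hq => by simp [downloadDim, hq]) (fun q hq => by simp [downloadDim, hq])
      (by simp [helperMemory, he]) (fun q hq => by simp [returnDim, hq])
      (fun q hq => by simp [returnDim, hq]) (by simp [hubOutcomes])
  · have hone : hubOutcomes e Q p = 1 := by simp [hubOutcomes, hp]
    simp only [hubRound, if_neg hp,
      moveOp_complete (isRegister_idle_received hp) (isRegister_idle_sent hp)]
    simp [hone]

/-- The download-and-return protocol. -/
noncomputable def downloadAndReturn (f : I → (Fin n → Fin Q) → ℂ) (e : Fin n) (T : Finset (Fin n))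
    (he : e ∉ T) (α : ℂ) (complete : ∀ p, ∑ k : Fin (hubOutcomes e Q p),
      (hubRound f e T α p k).conjTranspose * hubRound f e T α p k = 1) :
    StorageProtocol Q (starNetwork e T) :=
  .round (helperMemory T Q) (downloadDim e T Q)
    (fun _ _ => downloadDim_eq_one he)
    (fun _ => 1) (fun _ _ => moveOp)
    (fun p => by
      rw [Fin.sum_univ_one]
      exact moveOp_complete (m := fun _ => Q) (μ := fun _ _ => 1) isRegister_initial
        (isRegister_download_sent p))
    fun _ => .round (helperMemory T Q) (returnDim e T Q)
      (fun _ _ => returnDim_eq_one he)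
      (hubOutcomes e Q) (fun p k => hubRound f e T α p k) complete
      fun _ => .round (fun _ => Q) (fun _ _ => 1) (fun _ _ _ => rfl) (fun _ => 1)
        (fun _ _ => moveOp)
        (fun p => by
          rw [Fin.sum_univ_one]
          exact moveOp_complete (m' := fun _ => Q) (μ' := fun _ _ => 1)
            (isRegister_return_received p) isRegister_initial)
        fun _ => .done

theorem isDownloadAndReturn_downloadAndReturn (f : I → (Fin n → Fin Q) → ℂ) (he : e ∉ T) (α : ℂ)
    (complete) : IsDownloadAndReturn e T (downloadAndReturn f e T he α complete) := by
  refine ⟨⟨_, rfl, fun _ => ⟨_, rfl, fun _ => ⟨_, rfl, fun _ => rfl⟩⟩⟩,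
    fun _ _ _ => rfl, fun _ => ⟨fun p hp _ => ?_, fun _ => ⟨fun _ _ _ => rfl, fun _ => trivial⟩⟩⟩
  simp only [hubRound, if_neg hp]
  rfl

theorem channelDim_downloadAndReturn (f : I → (Fin n → Fin Q) → ℂ) (he : e ∉ T) (α : ℂ)
    (complete) {j : Fin n} (hj : j ∈ T) :
    (downloadAndReturn f e T he α complete).channelDim s(j, e) = Q ^ 2 := by
  have hje : j ≠ e := ne_of_mem_of_not_mem hj he
  -- An empty set of outcomes would make the supremum in `channelDim` equal to 0.
  have hout : Nonempty (∀ p, Fin (hubOutcomes e Q p)) := by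
    refine ⟨fun p => ⟨0, ?_⟩⟩
    have := NeZero.pos Q
    unfold hubOutcomes
    split_ifs
    · positivity
    · exact one_pos
  simp only [downloadAndReturn, Protocol.channelDim, Sym2.lift_mk,
    Finset.sup_const Finset.univ_nonempty]
  simp [downloadDim, returnDim, hj, hje, sq]

theorem cost_downloadAndReturn (hQ : 2 ≤ Q) (f : I → (Fin n → Fin Q) → ℂ) (he : e ∉ T) (α : ℂ)
    (complete) : (downloadAndReturn f e T he α complete).cost = 2 * (T.card : ℝ) := by
  have hQ1 : (1 : ℝ) < Q := by exact_mod_cast (by omega : 1 < Q)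
  rw [cost_starNetwork he, Finset.sum_congr rfl fun j hj => by
    rw [channelDim_downloadAndReturn f he α complete hj]]
  have : Real.logb Q ((Q ^ 2 : ℕ) : ℝ) = 2 := by
    rw [Nat.cast_pow, ← Real.rpow_natCast, Real.logb_rpow (by linarith) (by linarith)]
    norm_num
  rw [this, Finset.sum_const, nsmul_eq_mul, mul_comm]

/-- The state after the round in which the hub operates, if `g` is the state before it. -/
noncomputable def hubState (f : I → (Fin n → Fin Q) → ℂ) (e : Fin n) (T : Finset (Fin n)) (α : ℂ)
    (k : ℕ) (g : (Fin n → Fin Q) → Fin Q → ℂ) (r' : Fin n → Fin Q) (z : Fin Q) : ℂ :=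
  ∑ r : Fin n → Fin Q, if ∀ p, p ∉ insert e T → r p = r' p then
    (if (r e : ℕ) = k % Q then α * hubKernel f T e (Fin.ofNat Q (k / Q)) r' r else 0) * g r z else 0

/-- Nodes outside `T ∪ {e}` keep their qudits, which gives the agreement condition in `hubState`.
The helpers hold only trivial systems before this round, so their factors are 1. -/
theorem applyLocal_hubRound (f : I → (Fin n → Fin Q) → ℂ) (he : e ∉ T) (α : ℂ)
    (k : Fin n → ℕ) {ψ : State Q (helperMemory T Q) (downloadDim e T Q)}
    {g : (Fin n → Fin Q) → Fin Q → ℂ}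
    (hψ : ∀ x y z, ψ x y z = g (fun p => Fin.ofNat Q (regVal (x p, y p))) z) (x' y' z) :
    applyLocal (fun p => hubRound f e T α p (k p)) ψ x' y' z =
      hubState f e T α (k e) g (fun p => Fin.ofNat Q (regVal (x' p, fun q => y' q p))) z := by
  set r' : Fin n → Fin Q := fun p => Fin.ofNat Q (regVal (x' p, fun q => y' q p)) with hr'
  have hr'val : ∀ p, (r' p : ℕ) = regVal (x' p, fun q => y' q p) := fun p =>
    Nat.mod_eq_of_lt ((isRegister_return_received p).lt _)
  have hme : helperMemory T Q e = Q := by simp [helperMemory, he]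
  have hmT : ∀ p ∈ T, helperMemory T Q p = 1 := fun p hp => by simp [helperMemory, hp]
  have hd₁ : ∀ q ∈ T, downloadDim e T Q q e = Q := fun q hq => by simp [downloadDim, hq]
  have hd₂ : ∀ q, q ∉ T → downloadDim e T Q q e = 1 := fun q hq => by simp [downloadDim, hq]
  have hd₃ : ∀ p, p ∉ T → ∀ q, downloadDim e T Q p q = 1 := fun p hp q => by
    simp [downloadDim, hp]
  have hd₄ : ∀ p q, q ≠ e → downloadDim e T Q p q = 1 := fun p q hq => by
    simp [downloadDim, hq]
  have hu₁ : ∀ q ∈ T, returnDim e T Q e q = Q := fun q hq => by simp [returnDim, hq]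
  have hu₂ : ∀ q, q ∉ T → returnDim e T Q e q = 1 := fun q hq => by simp [returnDim, hq]
  have hu₃ : ∀ p, p ∉ T → ∀ q, returnDim e T Q q p = 1 := fun p hp q => by
    simp [returnDim, hp]
  have hu₄ : ∀ q p, q ≠ e → returnDim e T Q q p = 1 := fun p q hq => by
    simp [returnDim, hq]
  have hmain : ∀ (x : ∀ p, Fin (helperMemory T Q p)) (y : ∀ p q, Fin (downloadDim e T Q p q)),
      (∏ p, hubRound f e T α p (k p) (x' p, fun q => y' p q) (x p, fun q => y q p)) * ψ x y z =
      (fun r : Fin n → Fin Q => if ∀ p, p ∉ insert e T → r p = r' p then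
          (if (r e : ℕ) = k e % Q then
            α * hubKernel f T e (Fin.ofNat Q (k e / Q)) r' r else 0) * g r z else 0)
        (fun p => Fin.ofNat Q (regVal (x p, y p))) := by
    intro x y
    rw [hψ]
    set r : Fin n → Fin Q := fun p => Fin.ofNat Q (regVal (x p, y p)) with hr
    have hrval : ∀ p, (r p : ℕ) = regVal (x p, y p) := fun p =>
      Nat.mod_eq_of_lt ((isRegister_download_sent p).lt _)
    have hmove : ∀ p ∈ Finset.univ.erase e,
        hubRound f e T α p (k p) (x' p, fun q => y' p q) (x p, fun q => y q p) =
        if p ∉ insert e T → r p = r' p then 1 else 0 := by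
      intro p hp
      have hpe : p ≠ e := Finset.ne_of_mem_erase hp
      rw [hubRound, if_neg hpe, moveOp_apply]
      refine if_congr ?_ rfl rfl
      rw [regVal_eq_memory (hd₄ · p hpe), regVal_eq_memory (hu₄ p · hpe)]
      by_cases hpT : p ∈ T
      · have h1 : p ∈ insert e T := Finset.mem_insert_of_mem hpT
        simp only [h1, not_true_eq_false, false_imp_iff, iff_true]
        rw [val_eq_zero_of_eq_one (hmT p hpT), val_eq_zero_of_eq_one (hmT p hpT)]
      · have h1 : p ∉ insert e T := by simp [hpe, hpT]
        simp only [h1, not_false_eq_true, true_imp_iff, Fin.ext_iff, hrval, hr'val]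
        rw [regVal_eq_memory (hd₃ p hpT), regVal_eq_memory (hu₃ p hpT)]
        exact eq_comm
    have hhub : hubRound f e T α e (k e) (x' e, fun q => y' e q) (x e, fun q => y q e) =
        if (r e : ℕ) = k e % Q then
            α * hubKernel f T e (Fin.ofNat Q (k e / Q)) r' r else 0 := by
      rw [hubRound, if_pos rfl]
      simp only [hubOp, Matrix.of_apply]
      have h1 : (r e : ℕ) = x e := by rw [hrval, regVal_eq_memory (hd₃ e he)]
      rw [h1]
      refine if_congr Iff.rfl ?_ rfl
      congr 1
      rw [hubKernel_congr_right f T e _ _ (s := r), hubKernel_congr_left f T e _ _ (s' := r')]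
      · intro p hp
        apply Fin.ext
        rw [hr'val]
        by_cases hpe : p = e
        · subst hpe
          rw [val_hubConfig_self hme, regVal_eq_memory (hu₃ p he)]
        · have hpT : p ∈ T := (Finset.mem_insert.1 hp).resolve_left hpe
          rw [val_hubConfig_of_ne hu₁ hu₂ _ hpe,
            regVal_eq_message (hmT p hpT) (q₀ := e) (fun q hq => hu₄ q p hq)]
      · intro p hp
        apply Fin.ext
        rw [hrval, val_hubConfig_of_ne hd₁ hd₂ _ (ne_of_mem_of_not_mem hp he),
          regVal_eq_message (hmT p hp) (q₀ := e) (fun q hq => hd₄ p q hq)]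
    rw [← Finset.mul_prod_erase _ _ (Finset.mem_univ e), hhub, Finset.prod_congr rfl hmove,
      Finset.prod_ite_zero, Finset.prod_const_one]
    have hiff : (∀ p ∈ Finset.univ.erase e, p ∉ insert e T → r p = r' p) ↔
        ∀ p, p ∉ insert e T → r p = r' p :=
      ⟨fun h p hp => h p (Finset.mem_erase.2 ⟨fun h2 => hp (by simp [h2]), Finset.mem_univ p⟩) hp,
        fun h p _ => h p⟩
    simp only [hiff, mul_ite, mul_one, mul_zero, ite_mul, zero_mul]
  unfold applyLocal
  simp only [hmain]
  exact sum_config isRegister_download_sent fun r => if ∀ p, p ∉ insert e T → r p = r' p then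
          (if (r e : ℕ) = k e % Q then
            α * hubKernel f T e (Fin.ofNat Q (k e / Q)) r' r else 0) * g r z else 0

theorem corrects_downloadAndReturn [DecidableEq I] {C : Submodule ℂ (Qudits Q n)}
    {f : I → Qudits Q n} (hspan : ∀ φ ∈ C, ∃ a : I → ℂ, φ = ∑ i, a i • f i) (he : e ∉ T)
    (hiso : Isometric (fun i x => f i x) T) (α : ℂ) (complete) :
    Corrects C e (downloadAndReturn (fun i x => f i x) e T he α complete) := by
  intro φ hφ χ hχ
  obtain ⟨a, ha⟩ := hspan φ hφ
  obtain ⟨v₁, v₂, v₃, rfl⟩ := hχ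
  set k : Fin n → ℕ := fun p => v₂ p with hk
  set c := (Fintype.card ((Tᶜ : Finset (Fin n)) → Fin Q) : ℂ)⁻¹ *
    fiberCard (Fin Q) (insert e T) with hc
  -- The erased qudit is left in the measured basis state `k e / Q`, up to scale. Outcomes with `k e
  -- % Q ≠ 0` have amplitude zero because the hub's memory starts in `|0⟩`.
  refine ⟨fun z => if k e % Q = 0 then α * if z = Fin.ofNat Q (k e / Q) then c else 0 else 0,
    fun x y z => ?_⟩
  have h1 := applyLocal_moveOp (m' := helperMemory T Q) (μ' := downloadDim e T Q)
    (fun _ => isRegister_initial) isRegister_download_sent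
    (ψ := erasedState e φ)
    (g := fun r z => if (r e : ℕ) = 0 then φ (Function.update r e z) else 0) (by
      intro x y z
      have : (fun p => Fin.ofNat Q (regVal (x p, fun q => y q p))) = x := by
        ext p
        rw [regVal_eq_memory fun _ => rfl]
        exact Nat.mod_eq_of_lt (x p).2
      rw [this]
      rfl)
  have h2 := applyLocal_hubRound (fun i x => f i x) he α k
    (g := fun r z => if (r e : ℕ) = 0 then φ (Function.update r e z) else 0) h1
  have h3 := applyLocal_moveOp (m' := fun _ => Q) (μ' := fun _ _ => 1)
    isRegister_return_received (fun _ => isRegister_initial)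
    (g := hubState (fun i x => f i x) e T α (k e) fun r z =>
      if (r e : ℕ) = 0 then φ (Function.update r e z) else 0) h2 x y z
  refine h3.trans ?_
  have hx : (fun p => Fin.ofNat Q (regVal (x p, y p))) = x := by
    ext p
    rw [regVal_eq_memory fun _ => rfl]
    exact Nat.mod_eq_of_lt (x p).2
  rw [hx, hubState]
  have hφx : ∀ x, φ x = ∑ j, a j * f j x := by
    intro x
    rw [ha]
    simp
  by_cases hk0 : k e % Q = 0
  · simp only [hk0, if_true]
    have h4 : ∀ r : Fin n → Fin Q, (if ∀ p, p ∉ insert e T → r p = x p then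
        (if (r e : ℕ) = 0 then
          α * hubKernel (fun i x => f i x) T e (Fin.ofNat Q (k e / Q)) x r else 0) *
        (if (r e : ℕ) = 0 then φ (Function.update r e z) else 0) else 0) =
        ∑ j, α * a j * if (∀ p, p ∉ insert e T → r p = x p) ∧ r e = 0 then
          hubKernel (fun i x => f i x) T e (Fin.ofNat Q (k e / Q)) x r *
            f j (Function.update r e z) else 0 := by
      intro r
      have h5 : (r e : ℕ) = 0 ↔ r e = 0 := by rw [Fin.ext_iff]; rfl
      simp only [h5, hφx]
      by_cases h6 : ∀ p, p ∉ insert e T → r p = x p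
      · by_cases h7 : r e = 0
        · simp only [if_pos h6, if_pos h7, if_pos (And.intro h6 h7), Finset.mul_sum]
          exact Finset.sum_congr rfl fun _ _ => by ring
        · have h8 : ¬ ((∀ p, p ∉ insert e T → r p = x p) ∧ r e = 0) := fun h => h7 h.2
          simp [h7]
      · have h8 : ¬ ((∀ p, p ∉ insert e T → r p = x p) ∧ r e = 0) := fun h => h6 h.1
        rw [if_neg h6]
        simp only [if_neg h8, mul_zero, Finset.sum_const_zero]
    rw [Finset.sum_congr rfl fun r _ => h4 r, Finset.sum_comm]
    simp only [← Finset.mul_sum]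
    have h9 := fun j => sum_hubKernel_mul he hiso j 0 (Fin.ofNat Q (k e / Q)) z x
    have h10 : ∀ j, ∑ r : Fin n → Fin Q, (if (∀ p, p ∉ insert e T → r p = x p) ∧ r e = 0 then
          hubKernel (fun i x => f i x) T e (Fin.ofNat Q (k e / Q)) x r *
            f j (Function.update r e z) else 0) =
        f j x * if z = Fin.ofNat Q (k e / Q) then c else 0 := fun j => by
      rw [hc, ← h9 j]
      exact Finset.sum_congr rfl fun r _ => by congr
    rw [Finset.sum_congr rfl fun j _ => by rw [h10 j], hφx, Finset.sum_mul]
    exact Finset.sum_congr rfl fun _ _ => by ring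
  · simp only [if_neg hk0, mul_zero]
    refine Finset.sum_eq_zero fun r _ => ?_
    split_ifs with h6 h7 h8
    · exact absurd (h7.symm.trans h8) hk0
    all_goals simp

theorem exists_downloadAndReturn {t : ℕ} (hQ : 2 ≤ Q) (htn : t < n) (hn : n ≤ 2 * t)
    {C : Submodule ℂ (Qudits Q n)} (hC : IsQuantumMDS (2 * t - n) C) (he : e ∉ T)
    (hT : T.card = t) :
    ∃ P : StorageProtocol Q (starNetwork e T), Corrects C e P ∧ IsDownloadAndReturn e T P ∧
      P.cost = 2 * (t : ℝ) := by
  obtain ⟨f, -, hspan, hmix⟩ := hC.exists_maxMixed hQ htn hn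
  have hiso := isometric_of_maxMixed htn hn (hmix T hT) hT
  obtain ⟨α, hα⟩ : ∃ α : ℂ, conj α * α *
      ((Fintype.card (((insert e T)ᶜ : Finset (Fin n)) → Fin Q) : ℂ)⁻¹ *
        (fiberCard (Fin Q) (insert e T) * (Fintype.card (Fin Q) *
          Fintype.card (Fin (Q ^ (2 * t - n)))))) = 1 := by
    obtain ⟨ρ, hρ, hρc⟩ : ∃ ρ : ℝ, 0 < ρ ∧
        (Fintype.card (((insert e T)ᶜ : Finset (Fin n)) → Fin Q) : ℂ)⁻¹ *
        (fiberCard (Fin Q) (insert e T) * (Fintype.card (Fin Q) *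
          Fintype.card (Fin (Q ^ (2 * t - n))))) = ρ := by
      refine ⟨(Fintype.card (((insert e T)ᶜ : Finset (Fin n)) → Fin Q) : ℝ)⁻¹ *
        ((Fintype.card (((insert e T)ᶜ : Finset (Fin n)) → Fin Q) : ℝ)⁻¹ *
          Fintype.card (Fin n → Fin Q) * (Fintype.card (Fin Q) *
          Fintype.card (Fin (Q ^ (2 * t - n))))), ?_, ?_⟩
      · have : 0 < Q := by omega
        have h : ∀ (β : Type) [Fintype β] [Nonempty β], (0 : ℝ) < Fintype.card β := fun β _ _ => by
          exact_mod_cast Fintype.card_pos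
        have : Nonempty (Fin (Q ^ (2 * t - n))) := ⟨⟨0, by positivity⟩⟩
        exact mul_pos (inv_pos.2 (h _)) (mul_pos (mul_pos (inv_pos.2 (h _)) (h _))
          (mul_pos (h _) (h _)))
      · rw [fiberCard]
        push_cast
        rfl
    -- The normalization constant is a positive real, so its inverse square root solves `|α|² ρ =
    -- 1`.
    refine ⟨((Real.sqrt ρ)⁻¹ : ℝ), ?_⟩
    rw [hρc, Complex.conj_ofReal]
    norm_cast
    rw [← mul_inv, Real.mul_self_sqrt hρ.le, inv_mul_cancel₀ hρ.ne']
  have hcomp := hubRound_complete he hiso (hmix T hT) hα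
  refine ⟨downloadAndReturn (fun i x => f i x) e T he α hcomp,
    corrects_downloadAndReturn hspan he hiso α hcomp,
    isDownloadAndReturn_downloadAndReturn _ he α hcomp, ?_⟩
  rw [cost_downloadAndReturn hQ, hT]

end DownloadAndReturn

end ErasureCorrection

/-! ### The exact cost over the star network. -/

theorem mainTheorem1 (Q n t : ℕ) (hQ : 2 ≤ Q) (ht : 1 < t) (htn : t < n) (hn : n ≤ 2 * t)
    (C : Submodule ℂ (ErasureCorrection.Qudits Q n))
    (hC : ErasureCorrection.IsQuantumMDS (2 * t - n) C)
    (e : Fin n) (T : Finset (Fin n)) (heT : e ∉ T) (hT : T.card = t) :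
    ErasureCorrection.entanglementCost C e (ErasureCorrection.starNetwork e T) = 2 * (t : ℝ) ∧
    IsLeast (ErasureCorrection.costs C e (ErasureCorrection.starNetwork e T)) (2 * (t : ℝ)) ∧
    ∃ P : ErasureCorrection.StorageProtocol Q (ErasureCorrection.starNetwork e T),
      ErasureCorrection.Corrects C e P ∧
      ErasureCorrection.IsDownloadAndReturn e T P ∧ P.cost = 2 * (t : ℝ) := by
  have : NeZero Q := ⟨by omega⟩
  obtain ⟨P, hP, hdr, hcost⟩ :=
    ErasureCorrection.exists_downloadAndReturn hQ htn hn hC heT hT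
  have hleast : IsLeast (ErasureCorrection.costs C e (ErasureCorrection.starNetwork e T))
      (2 * (t : ℝ)) := by
    refine ⟨⟨P, hP, hcost⟩, ?_⟩
    rintro c ⟨P', hP', rfl⟩
    exact ErasureCorrection.two_mul_le_cost hQ ht htn hn hC heT hT P' hP'
  exact ⟨hleast.csInf_eq, hleast, P, hP, hdr, hcost⟩
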